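/- **Model.** There are $k$ sites with point-to-point channels. A protocol proceeds in turns: the transcript so far (the list of all messages, with sender and recipient) determines which site speaks next, or that the communication ends and which site then reports the answer. The speaking site chooses a recipient and a nonempty bit string, and the reporting site chooses the answer, as arbitrary functions of its own input and of the messages that it has itself sent or received. A randomized protocol is a random choice of such a protocol (shared randomness, so in particular private random tapes, is allowed). Its cost is the maximum, over all admissible inputs and all outcomes of the randomness, of the total number of bits in all messages. $R^{1/3}(f)$ denotes the minimum cost of a randomized protocol that, on every admissible input, reports the value of $f$ with error probability at most $1/3$. **Problems.** Each site $i\in\{1,\dots,k\}$ holds a set $E_i$ of edges on the vertex set $\{1,\dots,n\}$, where $E_1,\dots,E_k$ are pairwise disjoint (no edge duplication). In the *connectivity* problem the sites decide whether $G=(\{1,\dots,n\},\bigcup_i E_i)$ is connected; in the problem *#CC* they compute the number of connected components of $G$. **Statement.** Put $r=\min\{n,m/k\}$; all logarithms are to base $2$. 1. There are absolute constants $C,c>0$ such that for all integers $n,m,k\ge 0$ with $C\log n\le k\le\min\{n,m\}$ and $m\ge n$, $$R^{1/3}(\text{connectivity})\ \ge\ c\,\frac{kr}{\log k}\qquad\text{and}\qquad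 R^{1/3}(\#\mathrm{CC})\ \ge\ c\,\frac{kr}{\log k},$$ where the admissible inputs are the edge-partitioned graphs without edge duplication on $n$ vertices with at most $m$ edges. 2. For every $\varepsilon>0$ there are constants $C,c>0$, depending only on $\varepsilon$, such that both inequalities hold for all integers $n,m,k\ge 0$ with $C\log n\le k\le\min\{n,m\}$ and $n\le m\le(1-\varepsilon)\binom n2$, even if only the edge-partitioned graphs without edge duplication on $n$ vertices with exactly $m$ edges are admissible. (For $k\le 1$, where $\log k$ is not positive, the quantity $kr/\log k$ is read as $0$.) -/

import Mathlib

open scoped ENNReal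

namespace MessagePassing

/-- A message travels from one site to one other site and is a nonempty string of bits. -/
structure Message (k : ℕ) where
  src : Fin k
  dst : Fin k
  bits : {b : List Bool // b ≠ []}

/-- All messages sent so far, in chronological order. -/
abbrev Transcript (k : ℕ) := List (Message k)

/-- The total number of bits exchanged. -/
def Transcript.cost {k : ℕ} (t : Transcript k) : ℕ :=
  (t.map fun msg => msg.bits.1.length).sum

/-- What site `i` sees of a transcript: only the messages that it has sent or received. -/
def Transcript.view {k : ℕ} (t : Transcript k) (i : Fin k) : Transcript k :=
  t.filter fun msg => decide (msg.src = i ∨ msg.dst = i)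

/-- What happens next: some site sends a message, or the communication is over and some site
reports the answer. -/
inductive Turn (k : ℕ) where
  | speak (i : Fin k)
  | report (i : Fin k)

/-- A deterministic protocol for `k` sites, each holding an input in `X`, with answers in `β`.
The transcript specifies whose turn it is. The speaking site chooses a recipient and a message, and
the reporting site chooses the answer, as arbitrary functions of its own input and its own view. -/
structure Protocol (k : ℕ) (X β : Type) where
  turn : Transcript k → Turn k
  send : Fin k → X → Transcript k → Fin k × {b : List Bool // b ≠ []}
  answer : Fin k → X → Transcript k → β

namespace Protocol

variable {k : ℕ} {X β : Type}

/-- One turn of the protocol on the input `x`; once a site reports, nothing more is sent. -/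
def next (P : Protocol k X β) (x : Fin k → X) (t : Transcript k) : Transcript k :=
  match P.turn t with
  | .speak i =>
      t ++ [⟨i, (P.send i (x i) (t.view i)).1, (P.send i (x i) (t.view i)).2⟩]
  | .report _ => t

/-- On the input `x` the communication ends with the transcript `t`, and site `i` reports. -/
def EndsWith (P : Protocol k X β) (x : Fin k → X) (t : Transcript k) (i : Fin k) : Prop :=
  (∃ s : ℕ, (P.next x)^[s] [] = t) ∧ P.turn t = .report i

/-- On the input `x` the protocol ends after an exchange of at most `b` bits. -/
def CostAtMost (P : Protocol k X β) (x : Fin k → X) (b : ℕ) : Prop :=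
  ∃ t i, P.EndsWith x t i ∧ t.cost ≤ b

/-- On the input `x` the protocol ends and the answer `a` is reported. -/
def Outputs (P : Protocol k X β) (x : Fin k → X) (a : β) : Prop :=
  ∃ t i, P.EndsWith x t i ∧ P.answer i (x i) (t.view i) = a

end Protocol

/-- A randomized protocol with cost at most `b` and error probability at most `δ` for computing `f`
on the inputs in `D`. The protocol is drawn from a probability space, that is, the sites see common
random bits; private random tapes are the case where `Ω` is a product with a factor for each site
and each site uses its own factor only. The cost is bounded on every input in `D` and for every
outcome of the randomness. The error event has (outer) measure at most `δ`. -/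
def HasRandomizedProtocol {k : ℕ} {X β : Type} (D : Set (Fin k → X)) (f : (Fin k → X) → β)
    (δ : ℝ≥0∞) (b : ℕ) : Prop :=
  ∃ (Ω : Type) (_ : MeasurableSpace Ω) (μ : MeasureTheory.Measure Ω)
    (_ : MeasureTheory.IsProbabilityMeasure μ) (P : Ω → Protocol k X β),
    (∀ x ∈ D, ∀ ω, (P ω).CostAtMost x b) ∧
    ∀ x ∈ D, μ {ω | ¬ (P ω).Outputs x (f x)} ≤ δ

/-- The randomized `δ`-error communication complexity of `f` on the inputs in `D`: the minimum
cost of a randomized protocol with error probability at most `δ`. -/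
noncomputable def randCC {k : ℕ} {X β : Type} (D : Set (Fin k → X)) (f : (Fin k → X) → β)
    (δ : ℝ≥0∞) : ℕ∞ :=
  ⨅ (b : ℕ) (_ : HasRandomizedProtocol D f δ b), (b : ℕ∞)

/-- The graph whose edges are distributed among the sites. -/
def unionGraph {k n : ℕ} (x : Fin k → SimpleGraph (Fin n)) : SimpleGraph (Fin n) :=
  ⨆ i, x i

/-- The inputs without edge duplication: each of the `k` sites holds a set of edges on the vertex
set `Fin n`, no edge is held by two sites, and the total number of edges lies in `M`. -/
def edgePartitions (k n : ℕ) (M : Set ℕ) : Set (Fin k → SimpleGraph (Fin n)) :=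
  {x | Pairwise (fun i j => Disjoint (x i) (x j)) ∧ (unionGraph x).edgeSet.ncard ∈ M}

/-- The connectivity problem: is the union graph connected? -/
def connectivity (k n : ℕ) (x : Fin k → SimpleGraph (Fin n)) : Prop :=
  (unionGraph x).Connected

/-- The #CC problem: the number of connected components of the union graph. -/
noncomputable def numComponents (k n : ℕ) (x : Fin k → SimpleGraph (Fin n)) : ℕ :=
  Nat.card (unionGraph x).ConnectedComponent

/-- The quantity `k * r / log k` with `r = min {n, m / k}` and the logarithm to base 2. -/
noncomputable def boundExpr (n m k : ℕ) : ℝ :=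
  (k : ℝ) * min (n : ℝ) ((m : ℝ) / (k : ℝ)) / Real.logb 2 (k : ℝ)

end MessagePassing

/-! The source of hardness is set disjointness. A common party holds `y`, each of `K` players holds
a set `z i`, all in a universe of `r` coordinates, and at most one pair `(i, j)` is a crossing, i.e.
`j` lies in both `z i` and `y`. In the hard distribution a coin `d j` decides for each coordinate
which side gets a uniform bit while the other side gets `false`. Given `y`, the players are
independent copies.

From the point of view of one player, a protocol partitions the inputs into rectangles indexed by
that player's view, so given the coins the leaf probabilities factor. The level-one inequality
bounds the Hellinger effect of a single bit, summed over coordinates, by the entropy of the leaf.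
Cut and paste turns this into a comparison of the bit pairs `(0, 0)` and `(1, 1)`
(`sum_expect_hellinger_le_entropy`). Hence planting a crossing at a random place is noticeable only
if the entropies of the views, summed over the players, are of order `K * r` (`plantedProb_sub_le`).
By the Gibbs and Kraft inequalities the entropy of a view is, up to an additive constant, at most
its expected length in bits times `log (8 * k ^ 2)`, which is the origin of the factor `1 / log k`.
A message lies in at most two views, so the views together contain at most twice the bits sent. This
gives `le_cost_of_encodes_disjointness`.

Two gadgets encode disjointness as connectivity with a number of edges that does not depend on the
input: `denseGadget` for `m ≥ 2 * n`, and `sparseGadget`, based on a commutator in the symmetric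
group on three strands, for `m < 2 * n`. Padding reaches exactly `n` vertices and `m` edges. Taking
`K` proportional to `k` and `r` to `min n (m / k)` gives the second statement. The first follows by
truncating `m` at `n * n / 4`, and #CC is at least as hard because the number of components reveals
connectivity. -/

namespace MessagePassing

/-! ### Influence of single bits on functions on the cube: the level-one inequality. -/

section Cube

open Finset Function
open scoped BigOperators

/-- The Boolean cube. -/
abbrev Cube (r : ℕ) := Fin r → Bool

variable {r : ℕ}

/-- Keep the coordinates selected by `d` and set all others to `false`. -/
def mask (d u : Cube r) : Cube r := fun j => d j && u j

/-- The complementary selection of coordinates. -/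
def compl (d : Cube r) : Cube r := fun j => !d j

/-- The Rademacher character of a bit. -/
def sign (b : Bool) : ℝ := if b then -1 else 1

/-- The mean of `f` over the subcube of the coordinates selected by `d`. -/
noncomputable def subcubeMean (f : Cube r → ℝ) (d : Cube r) : ℝ := 𝔼 u, f (mask d u)

/-- The mean of `f` over the subcube selected by `d` with coordinate `j` overwritten by `c`. -/
noncomputable def sliceMean (f : Cube r → ℝ) (d : Cube r) (j : Fin r) (c : Bool) : ℝ :=
  𝔼 u, f (update (mask d u) j c)

lemma expect_update (F : Cube r → ℝ) (j : Fin r) :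
    𝔼 u, F u = ((𝔼 u, F (update u j false)) + 𝔼 u, F (update u j true)) / 2 := by
  have hflip : 𝔼 u, F (update u j (!u j)) = 𝔼 u, F u := by
    have hinv : Involutive fun u : Cube r => update u j (!u j) := by
      intro u; simp
    exact Fintype.expect_equiv (hinv.toPerm _) _ _ fun u => rfl
  have hsum : (𝔼 u, F (update u j false)) + 𝔼 u, F (update u j true)
      = (𝔼 u, F u) + 𝔼 u, F (update u j (!u j)) := by
    rw [← expect_add_distrib, ← expect_add_distrib]
    refine expect_congr rfl fun u _ => ?_
    cases h : u j
    · have : update u j false = u := by rw [← h, update_eq_self]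
      simp [this]
    · have : update u j true = u := by rw [← h, update_eq_self]
      simp [this, add_comm]
  rw [hsum, hflip]; ring

lemma expect_exp_linear_le (c : Fin r → ℝ) :
    𝔼 u : Cube r, Real.exp (∑ j, c j * sign (u j)) ≤ Real.exp ((∑ j, c j ^ 2) / 2) := by
  have h1 : ∑ u : Cube r, Real.exp (∑ j, c j * sign (u j)) = ∏ j, (2 * Real.cosh (c j)) := by
    simp_rw [Real.exp_sum]
    have := Finset.prod_univ_sum (fun _ : Fin r => (univ : Finset Bool))
      (fun j b => Real.exp (c j * sign b))
    rw [Fintype.piFinset_univ] at this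
    rw [← this]
    refine prod_congr rfl fun j _ => ?_
    simp [sign, Real.cosh_eq]; ring
  rw [Fintype.expect_eq_sum_div_card, h1, prod_mul_distrib, prod_const]
  have : (Fintype.card (Cube r) : ℝ) = 2 ^ #(univ : Finset (Fin r)) := by simp
  rw [this, mul_div_cancel_left₀ _ (by positivity), sum_div, Real.exp_sum]
  exact prod_le_prod (fun j _ => (Real.cosh_pos _).le) fun j _ => Real.cosh_le_exp_half_sq _

/-- The level-one inequality. -/
lemma level_one_inequality (f : Cube r → ℝ) (h0 : ∀ u, 0 ≤ f u) (h1 : ∀ u, f u ≤ 1)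
    (hpos : 0 < 𝔼 u, f u) :
    ∑ j, (𝔼 u, f u * sign (u j)) ^ 2 ≤ 2 * (𝔼 u, f u) ^ 2 * -Real.log (𝔼 u, f u) := by
  set α := 𝔼 u, f u with hα
  set c : Fin r → ℝ := fun j => 𝔼 u, f u * sign (u j) with hc
  set s := ∑ j, c j ^ 2 with hs
  -- Exponential tilt in the direction of the level-one coefficients. Bounding the mean of `f * exp
  -- L` from both sides gives the claim.
  set L : Cube r → ℝ := fun u => ∑ j, (c j / α) * sign (u j) with hL
  have hfL : 𝔼 u, f u * L u = s / α := by
    simp_rw [hL, mul_sum]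
    rw [expect_sum_comm, hs, sum_div]
    refine sum_congr rfl fun j _ => ?_
    have : ∀ u, f u * (c j / α * sign (u j)) = (c j / α) * (f u * sign (u j)) := fun u => by ring
    simp_rw [this, ← mul_expect]
    change c j / α * c j = _
    ring
  have hlow : Real.exp (s / α ^ 2) * α ≤ 𝔼 u, f u * Real.exp (L u) := by
    -- Jensen's inequality by hand: the tangent of `exp` at `s / α ^ 2`, the mean of `L` with
    -- respect to the density `f / α`.
    have hstep : ∀ u, Real.exp (s / α ^ 2) * (f u * (1 - s / α ^ 2)) +
        Real.exp (s / α ^ 2) * (f u * L u) ≤ f u * Real.exp (L u) := by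
      intro u
      have := Real.add_one_le_exp (L u - s / α ^ 2)
      have he : Real.exp (L u) = Real.exp (s / α ^ 2) * Real.exp (L u - s / α ^ 2) := by
        rw [← Real.exp_add]; ring_nf
      rw [he]
      have h2 : 0 ≤ f u * Real.exp (s / α ^ 2) := mul_nonneg (h0 u) (Real.exp_pos _).le
      nlinarith [mul_le_mul_of_nonneg_left this h2]
    have := expect_le_expect (s := univ) fun u _ => hstep u
    refine le_trans (le_of_eq ?_) this
    rw [expect_add_distrib, ← mul_expect, ← mul_expect, ← expect_mul, hfL, ← hα]
    field_simp
    ring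
  have hup : 𝔼 u, f u * Real.exp (L u) ≤ Real.exp (s / α ^ 2 / 2) := by
    calc 𝔼 u, f u * Real.exp (L u) ≤ 𝔼 u, Real.exp (L u) :=
          expect_le_expect fun u _ => mul_le_of_le_one_left (Real.exp_pos _).le (h1 u)
      _ ≤ _ := expect_exp_linear_le _
      _ = _ := by simp_rw [div_pow, ← sum_div]; rfl
  have hlog := Real.log_le_log (by positivity) (hlow.trans hup)
  rw [Real.log_mul (Real.exp_pos _).ne' hpos.ne', Real.log_exp, Real.log_exp] at hlog
  have : s / α ^ 2 ≤ 2 * -Real.log α := by linarith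
  rw [div_le_iff₀ (by positivity)] at this
  linarith

/-- Since `(x - y) ^ 2 = (√x - √y) ^ 2 * (√x + √y) ^ 2` and `(√x + √y) ^ 2 ≥ x + y`. -/
lemma sq_sqrt_sub_sqrt_mul_le {x y : ℝ} (hx : 0 ≤ x) (hy : 0 ≤ y) :
    (√x - √y) ^ 2 * (x + y) ≤ (x - y) ^ 2 := by
  obtain ⟨s, hs, rfl⟩ : ∃ s, 0 ≤ s ∧ x = s ^ 2 := ⟨√x, Real.sqrt_nonneg _, (Real.sq_sqrt hx).symm⟩
  obtain ⟨t, ht, rfl⟩ : ∃ s, 0 ≤ s ∧ y = s ^ 2 := ⟨√y, Real.sqrt_nonneg _, (Real.sq_sqrt hy).symm⟩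
  rw [Real.sqrt_sq hs, Real.sqrt_sq ht]
  have : (s ^ 2 - t ^ 2) ^ 2 - (s - t) ^ 2 * (s ^ 2 + t ^ 2) = (s - t) ^ 2 * (2 * s * t) := by ring
  have : 0 ≤ (s - t) ^ 2 * (2 * s * t) := by positivity
  linarith

lemma mask_update_of_true {d : Cube r} {j : Fin r} (h : d j = true) (u : Cube r) (c : Bool) :
    mask d (update u j c) = update (mask d u) j c := by
  ext i; by_cases hi : i = j
  · subst hi; simp [mask, h]
  · simp [mask, hi]

lemma update_mask_of_false {d : Cube r} {j : Fin r} (h : d j = false) (u : Cube r) :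
    update (mask d u) j false = mask d u := by
  ext i; by_cases hi : i = j
  · subst hi; simp [mask, h]
  · simp [hi]

/-- Coordinate `j` is overwritten anyway, so its coin is irrelevant. This makes slice means
independent of `d j` when averaging over `d`. -/
lemma sliceMean_update (f : Cube r → ℝ) (d : Cube r) (j : Fin r) (b c : Bool) :
    sliceMean f (update d j b) j c = sliceMean f d j c := by
  unfold sliceMean
  refine expect_congr rfl fun u _ => congrArg f ?_
  ext i; by_cases hi : i = j
  · subst hi; simp
  · simp [mask, hi]

lemma compl_update (d : Cube r) (j : Fin r) (b : Bool) :
    compl (update d j b) = update (compl d) j (!b) := by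
  ext i; by_cases hi : i = j
  · subst hi; simp [compl]
  · simp [compl, hi]

lemma sliceMean_false_of_false (f : Cube r → ℝ) {d : Cube r} {j : Fin r} (h : d j = false) :
    sliceMean f d j false = subcubeMean f d :=
  expect_congr rfl fun u _ => by rw [update_mask_of_false h]

lemma subcubeMean_eq_of_true (f : Cube r → ℝ) {d : Cube r} {j : Fin r} (h : d j = true) :
    subcubeMean f d = (sliceMean f d j false + sliceMean f d j true) / 2 := by
  unfold subcubeMean sliceMean
  rw [expect_update _ j]
  simp_rw [mask_update_of_true h]

lemma expect_mul_sign_of_true (f : Cube r → ℝ) {d : Cube r} {j : Fin r} (h : d j = true) :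
    𝔼 u, f (mask d u) * sign (u j) = (sliceMean f d j false - sliceMean f d j true) / 2 := by
  unfold sliceMean
  rw [expect_update _ j]
  simp_rw [mask_update_of_true h]
  simp [sign, ← expect_neg_distrib, sub_eq_add_neg]

lemma subcubeMean_nonneg {f : Cube r → ℝ} (h0 : ∀ u, 0 ≤ f u) (d : Cube r) :
    0 ≤ subcubeMean f d := expect_nonneg fun _ _ => h0 _

lemma sliceMean_nonneg {f : Cube r → ℝ} (h0 : ∀ u, 0 ≤ f u) (d : Cube r) (j : Fin r) (c : Bool) :
    0 ≤ sliceMean f d j c := expect_nonneg fun _ _ => h0 _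

lemma sum_sq_sqrt_sliceMean_le (f : Cube r → ℝ) (h0 : ∀ u, 0 ≤ f u) (h1 : ∀ u, f u ≤ 1)
    (d : Cube r) :
    ∑ j, (if d j then (√(sliceMean f d j false) - √(sliceMean f d j true)) ^ 2 else 0)
      ≤ 4 * Real.negMulLog (subcubeMean f d) := by
  rcases (subcubeMean_nonneg h0 d).eq_or_lt with h | hpos
  · rw [← h, Real.negMulLog_zero, mul_zero]
    refine sum_nonpos fun j _ => ?_
    split_ifs with hj
    · have h2 := subcubeMean_eq_of_true f hj
      have h3 := sliceMean_nonneg h0 d j false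
      have h4 := sliceMean_nonneg h0 d j true
      have h5 : sliceMean f d j false = 0 := by linarith
      have h6 : sliceMean f d j true = 0 := by linarith
      simp [h5, h6]
    · exact le_rfl
  · have hl := level_one_inequality (fun u => f (mask d u)) (fun _ => h0 _) (fun _ => h1 _) hpos
    change _ ≤ 2 * (subcubeMean f d) ^ 2 * -Real.log (subcubeMean f d) at hl
    set α := subcubeMean f d
    -- The two slices have mean `α`, and half their difference is the level-one coefficient at `j`.
    -- Dividing by their sum `2 * α` turns squared differences into squared differences of roots.
    have key : ∀ j, (if d j then (√(sliceMean f d j false) - √(sliceMean f d j true)) ^ 2 else 0)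
        ≤ 2 / α * (𝔼 u, f (mask d u) * sign (u j)) ^ 2 := by
      intro j
      split_ifs with hj
      · rw [expect_mul_sign_of_true f hj]
        have h2 : α = _ := subcubeMean_eq_of_true f hj
        have h3 := sq_sqrt_sub_sqrt_mul_le (sliceMean_nonneg h0 d j false)
          (sliceMean_nonneg h0 d j true)
        have h4 : sliceMean f d j false + sliceMean f d j true = 2 * α := by linarith
        rw [h4] at h3
        rw [div_mul_eq_mul_div, le_div_iff₀ hpos]
        nlinarith
      · positivity
    calc _ ≤ ∑ j, 2 / α * (𝔼 u, f (mask d u) * sign (u j)) ^ 2 := sum_le_sum fun j _ => key j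
      _ = 2 / α * ∑ j, (𝔼 u, f (mask d u) * sign (u j)) ^ 2 := by rw [mul_sum]
      _ ≤ 2 / α * (2 * α ^ 2 * -Real.log α) := by gcongr
      _ = _ := by rw [Real.negMulLog]; field_simp; ring

end Cube

end MessagePassing

namespace MessagePassing

/-! ### Hellinger distances between leaf distributions, and entropy. -/

section Hellinger

open Finset Function
open scoped BigOperators

variable {r : ℕ} {κ : Type*}

lemma expect_mul_expect_compl (f g : Cube r → ℝ) (F G : Cube r → Cube r) :
    (𝔼 u, f (F u)) * 𝔼 u, g (G u) = 𝔼 u, 𝔼 u', f (F u) * g (G u') := by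
  rw [expect_mul]; simp_rw [mul_expect]

/-- The probability of the leaf `l` in the product distribution given by `d`, with the bits at
coordinate `j` overwritten by `s` and `t`. -/
noncomputable def leafProb (a b : κ → Cube r → ℝ) (d : Cube r) (j : Fin r) (s t : Bool) (l : κ) :
    ℝ :=
  sliceMean (a l) d j s * sliceMean (b l) (compl d) j t

variable {Λ : Finset κ} {a b : κ → Cube r → ℝ}

lemma leafProb_nonneg (ha : ∀ l u, 0 ≤ a l u) (hb : ∀ l u, 0 ≤ b l u) (d : Cube r) (j : Fin r)
    (s t : Bool) (l : κ) : 0 ≤ leafProb a b d j s t l :=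
  mul_nonneg (sliceMean_nonneg (ha l) _ _ _) (sliceMean_nonneg (hb l) _ _ _)

lemma sum_leafProb (hab : ∀ x y, ∑ l ∈ Λ, a l x * b l y = 1) (d : Cube r) (j : Fin r)
    (s t : Bool) : ∑ l ∈ Λ, leafProb a b d j s t l = 1 := by
  unfold leafProb sliceMean
  simp_rw [expect_mul_expect_compl]
  simp_rw [← expect_sum_comm, hab]
  simp

lemma sum_subcubeMean_mul (hab : ∀ x y, ∑ l ∈ Λ, a l x * b l y = 1) (d : Cube r) :
    ∑ l ∈ Λ, subcubeMean (a l) d * subcubeMean (b l) (compl d) = 1 := by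
  unfold subcubeMean
  simp_rw [expect_mul_expect_compl]
  simp_rw [← expect_sum_comm, hab]
  simp

/-- At each coordinate only the side selected by `d` is free; the other side's `false` slice mean is
its full subcube mean. Summing thus gives the one-sided bounds for `a` and `b`, weighted by the mean
of the other, and these add up by the product rule for `Real.negMulLog`. -/
lemma sum_sq_sqrt_sub_le_entropy (ha : ∀ l u, 0 ≤ a l u) (ha1 : ∀ l u, a l u ≤ 1)
    (hb : ∀ l u, 0 ≤ b l u) (hb1 : ∀ l u, b l u ≤ 1) (d : Cube r) :
    ∑ j, (if d j then ∑ l ∈ Λ, sliceMean (b l) (compl d) j false *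
          (√(sliceMean (a l) d j false) - √(sliceMean (a l) d j true)) ^ 2
        else ∑ l ∈ Λ, sliceMean (a l) d j false *
          (√(sliceMean (b l) (compl d) j false) - √(sliceMean (b l) (compl d) j true)) ^ 2)
      ≤ 4 * ∑ l ∈ Λ, Real.negMulLog (subcubeMean (a l) d * subcubeMean (b l) (compl d)) := by
  have h1 : ∀ j, (if d j then ∑ l ∈ Λ, sliceMean (b l) (compl d) j false *
          (√(sliceMean (a l) d j false) - √(sliceMean (a l) d j true)) ^ 2
        else ∑ l ∈ Λ, sliceMean (a l) d j false *
          (√(sliceMean (b l) (compl d) j false) - √(sliceMean (b l) (compl d) j true)) ^ 2)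
      = ∑ l ∈ Λ, (subcubeMean (b l) (compl d) *
          (if d j then (√(sliceMean (a l) d j false) - √(sliceMean (a l) d j true)) ^ 2 else 0)
        + subcubeMean (a l) d * (if compl d j then
          (√(sliceMean (b l) (compl d) j false) - √(sliceMean (b l) (compl d) j true)) ^ 2
          else 0)) := by
    intro j
    cases hj : d j
    · have : compl d j = true := by simp [compl, hj]
      simp [this, sliceMean_false_of_false _ hj]
    · have : compl d j = false := by simp [compl, hj]
      simp [this, sliceMean_false_of_false _ this]
  simp_rw [h1]
  rw [sum_comm, mul_sum]
  refine sum_le_sum fun l _ => ?_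
  rw [sum_add_distrib, ← mul_sum, ← mul_sum, Real.negMulLog_mul]
  have h2 := mul_le_mul_of_nonneg_left (sum_sq_sqrt_sliceMean_le (a l) (ha l) (ha1 l) d)
    (subcubeMean_nonneg (hb l) (compl d))
  have h3 := mul_le_mul_of_nonneg_left (sum_sq_sqrt_sliceMean_le (b l) (hb l) (hb1 l) (compl d))
    (subcubeMean_nonneg (ha l) d)
  linarith

/-- The coin at `j` is independent of everything else in the `j`-th summand, so each branch is taken
with probability one half. This makes the changes of both sides available at the same coordinate. -/
lemma sum_expect_ite (F G : Fin r → Cube r → ℝ) (hF : ∀ j d c, F j (update d j c) = F j d)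
    (hG : ∀ j d c, G j (update d j c) = G j d) :
    𝔼 d, ∑ j, (if d j then F j d else G j d) = ∑ j, 𝔼 d, (F j d + G j d) / 2 := by
  rw [expect_sum_comm]
  refine sum_congr rfl fun j _ => ?_
  rw [expect_update _ j, ← expect_add_distrib, expect_div]
  refine expect_congr rfl fun d _ => ?_
  simp [hF, hG, add_comm]

/-- Cut and paste: the Hellinger distance between the leaf distributions for `(0, 0)` and `(1, 1)`
equals that for `(1, 0)` and `(0, 1)`. -/
lemma hellinger_cut_paste (ha : ∀ l u, 0 ≤ a l u) (hb : ∀ l u, 0 ≤ b l u)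
    (hab : ∀ x y, ∑ l ∈ Λ, a l x * b l y = 1) (d : Cube r) (j : Fin r) :
    ∑ l ∈ Λ, (√(leafProb a b d j false false l) - √(leafProb a b d j true true l)) ^ 2
      = ∑ l ∈ Λ, (√(leafProb a b d j true false l) - √(leafProb a b d j false true l)) ^ 2 := by
  have expand : ∀ s t s' t', ∑ l ∈ Λ, (√(leafProb a b d j s t l) - √(leafProb a b d j s' t' l)) ^ 2
      = 2 - 2 * ∑ l ∈ Λ, √(leafProb a b d j s t l) * √(leafProb a b d j s' t' l) := by
    intro s t s' t'
    have : ∀ l, (√(leafProb a b d j s t l) - √(leafProb a b d j s' t' l)) ^ 2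
        = leafProb a b d j s t l + leafProb a b d j s' t' l
          - 2 * (√(leafProb a b d j s t l) * √(leafProb a b d j s' t' l)) := by
      intro l
      have h1 := Real.sq_sqrt (leafProb_nonneg ha hb d j s t l)
      have h2 := Real.sq_sqrt (leafProb_nonneg ha hb d j s' t' l)
      linear_combination h1 + h2
    simp_rw [this]
    rw [sum_sub_distrib, sum_add_distrib, sum_leafProb hab, sum_leafProb hab, ← mul_sum]
    norm_num
  rw [expand, expand]
  congr 2
  refine sum_congr rfl fun l _ => ?_
  rw [← Real.sqrt_mul (leafProb_nonneg ha hb ..), ← Real.sqrt_mul (leafProb_nonneg ha hb ..)]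
  congr 1
  unfold leafProb; ring

/-- After cut and paste the pairs `(1, 0)` and `(0, 1)` are compared through `(0, 0)`, where each
step changes one factor only. The factor 2 is that of `(u - v) ^ 2 ≤ 2 * u ^ 2 + 2 * v ^ 2`. -/
lemma hellinger_le (ha : ∀ l u, 0 ≤ a l u) (hb : ∀ l u, 0 ≤ b l u)
    (hab : ∀ x y, ∑ l ∈ Λ, a l x * b l y = 1) (d : Cube r) (j : Fin r) :
    ∑ l ∈ Λ, (√(leafProb a b d j false false l) - √(leafProb a b d j true true l)) ^ 2
      ≤ 2 * (∑ l ∈ Λ, sliceMean (b l) (compl d) j false *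
          (√(sliceMean (a l) d j false) - √(sliceMean (a l) d j true)) ^ 2
        + ∑ l ∈ Λ, sliceMean (a l) d j false *
          (√(sliceMean (b l) (compl d) j false) - √(sliceMean (b l) (compl d) j true)) ^ 2) := by
  rw [hellinger_cut_paste ha hb hab, ← sum_add_distrib, mul_sum]
  refine sum_le_sum fun l _ => ?_
  unfold leafProb
  rw [Real.sqrt_mul (sliceMean_nonneg (ha l) ..), Real.sqrt_mul (sliceMean_nonneg (ha l) ..)]
  have hA := Real.sq_sqrt (sliceMean_nonneg (ha l) d j false)
  have hB := Real.sq_sqrt (sliceMean_nonneg (hb l) (compl d) j false)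
  set A := √(sliceMean (a l) d j false)
  set B := √(sliceMean (b l) (compl d) j false)
  rw [← hA, ← hB]
  nlinarith [sq_nonneg (B * (√(sliceMean (a l) d j true) - A) +
    A * (√(sliceMean (b l) (compl d) j true) - B))]

/-- The constant 16 is 4 from the level-one bound, 2 from the coin at `j` and 2 from the triangle
inequality. -/
lemma sum_expect_hellinger_le_entropy (ha : ∀ l u, 0 ≤ a l u) (ha1 : ∀ l u, a l u ≤ 1)
    (hb : ∀ l u, 0 ≤ b l u) (hb1 : ∀ l u, b l u ≤ 1)
    (hab : ∀ x y, ∑ l ∈ Λ, a l x * b l y = 1) :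
    ∑ j, 𝔼 d, ∑ l ∈ Λ,
        (√(leafProb a b d j false false l) - √(leafProb a b d j true true l)) ^ 2
      ≤ 16 * 𝔼 d, ∑ l ∈ Λ, Real.negMulLog (subcubeMean (a l) d * subcubeMean (b l) (compl d)) := by
  have h := expect_le_expect (s := univ) fun d _ =>
    sum_sq_sqrt_sub_le_entropy (Λ := Λ) ha ha1 hb hb1 d
  rw [sum_expect_ite, ← mul_expect] at h
  · have h2 := sum_le_sum (s := univ) fun j _ => expect_le_expect (s := univ) fun d _ =>
      hellinger_le ha hb hab d j
    simp_rw [← mul_expect] at h2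
    simp_rw [← expect_div] at h
    rw [← mul_sum] at h2
    rw [← sum_div] at h
    linarith
  · intro j d c
    simp_rw [compl_update, sliceMean_update]
  · intro j d c
    simp_rw [compl_update, sliceMean_update]

/-- The Gibbs inequality. -/
lemma sum_negMulLog_le {Λ : Finset κ} {p q : κ → ℝ} (hp : ∀ l, 0 ≤ p l) (hp1 : ∑ l ∈ Λ, p l = 1)
    (hq : ∀ l, 0 < q l) (hq1 : ∑ l ∈ Λ, q l ≤ 1) :
    ∑ l ∈ Λ, Real.negMulLog (p l) ≤ ∑ l ∈ Λ, p l * -Real.log (q l) := by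
  have : ∀ l, Real.negMulLog (p l) ≤ p l * -Real.log (q l) + (q l - p l) := by
    intro l
    rcases (hp l).eq_or_lt with h | h
    · simp [← h, (hq l).le]
    · have := Real.log_le_sub_one_of_pos (div_pos (hq l) h)
      rw [Real.log_div (hq l).ne' h.ne'] at this
      have h2 := mul_le_mul_of_nonneg_left this h.le
      have h3 : p l * (q l / p l - 1) = q l - p l := by field_simp
      rw [Real.negMulLog]
      linarith
  calc _ ≤ ∑ l ∈ Λ, (p l * -Real.log (q l) + (q l - p l)) := sum_le_sum fun l _ => this l
    _ = ∑ l ∈ Λ, p l * -Real.log (q l) + (∑ l ∈ Λ, q l - ∑ l ∈ Λ, p l) := by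
      rw [sum_add_distrib, sum_sub_distrib]
    _ ≤ _ := by linarith

/-- If the leaves are cheap, then planting a common element at a random coordinate hardly changes
the probability of any set `O` of leaves. -/
theorem sum_expect_leafProb_sub_le (ha : ∀ l u, 0 ≤ a l u) (ha1 : ∀ l u, a l u ≤ 1)
    (hb : ∀ l u, 0 ≤ b l u) (hb1 : ∀ l u, b l u ≤ 1)
    (hab : ∀ x y, ∑ l ∈ Λ, a l x * b l y = 1) {q : κ → ℝ} (hq : ∀ l, 0 < q l)
    (hq1 : ∑ l ∈ Λ, q l ≤ 1) {O : Finset κ} (hO : O ⊆ Λ) :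
    ∑ j, 𝔼 d, ∑ l ∈ O, (leafProb a b d j false false l - leafProb a b d j true true l)
      ≤ r / 12 + 192 * 𝔼 d, ∑ l ∈ Λ,
        subcubeMean (a l) d * subcubeMean (b l) (compl d) * -Real.log (q l) := by
  have hent : 𝔼 d, ∑ l ∈ Λ, Real.negMulLog (subcubeMean (a l) d * subcubeMean (b l) (compl d))
      ≤ 𝔼 d, ∑ l ∈ Λ, subcubeMean (a l) d * subcubeMean (b l) (compl d) * -Real.log (q l) :=
    expect_le_expect fun d _ => sum_negMulLog_le
      (fun l => mul_nonneg (subcubeMean_nonneg (ha l) _) (subcubeMean_nonneg (hb l) _))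
      (sum_subcubeMean_mul hab d) hq hq1
  have hpt : ∀ (d : Cube r) (j : Fin r),
      ∑ l ∈ O, (leafProb a b d j false false l - leafProb a b d j true true l)
      ≤ 12 * (∑ l ∈ Λ,
        (√(leafProb a b d j false false l) - √(leafProb a b d j true true l)) ^ 2) + 1 / 12 := by
    intro d j
    -- A difference is `(A - B) * (A + B)` in terms of roots; AM-GM balances it so that the second
    -- term contributes only `2 / 24` in total. Later `192 = 12 * 16`.
    have h1 : ∀ l, leafProb a b d j false false l - leafProb a b d j true true l
        ≤ 12 * (√(leafProb a b d j false false l) - √(leafProb a b d j true true l)) ^ 2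
          + (leafProb a b d j false false l + leafProb a b d j true true l) / 24 := by
      intro l
      have hA := Real.sq_sqrt (leafProb_nonneg ha hb d j false false l)
      have hB := Real.sq_sqrt (leafProb_nonneg ha hb d j true true l)
      set A := √(leafProb a b d j false false l)
      set B := √(leafProb a b d j true true l)
      rw [← hA, ← hB]
      nlinarith [sq_nonneg (24 * (A - B) - (A + B)), sq_nonneg (A - B)]
    calc _ ≤ ∑ l ∈ O, (12 * (√(leafProb a b d j false false l)
            - √(leafProb a b d j true true l)) ^ 2
          + (leafProb a b d j false false l + leafProb a b d j true true l) / 24) :=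
          sum_le_sum fun l _ => h1 l
      _ ≤ ∑ l ∈ Λ, (12 * (√(leafProb a b d j false false l)
            - √(leafProb a b d j true true l)) ^ 2
          + (leafProb a b d j false false l + leafProb a b d j true true l) / 24) :=
          sum_le_sum_of_subset_of_nonneg hO fun l _ _ => by
            have := leafProb_nonneg ha hb d j false false l
            have := leafProb_nonneg ha hb d j true true l
            positivity
      _ = _ := by
          rw [sum_add_distrib, ← mul_sum, ← sum_div, sum_add_distrib, sum_leafProb hab,
            sum_leafProb hab]
          norm_num
  have hsum := sum_le_sum (s := univ) fun j _ => expect_le_expect (s := univ) fun d _ => hpt d j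
  simp_rw [expect_add_distrib, ← mul_expect] at hsum
  rw [sum_add_distrib, ← mul_sum] at hsum
  have hc : ∑ _j : Fin r, 𝔼 _d : Cube r, (1 / 12 : ℝ) = r / 12 := by
    simp; ring
  rw [hc] at hsum
  have := sum_expect_hellinger_le_entropy (Λ := Λ) ha ha1 hb hb1 hab
  linarith

end Hellinger

end MessagePassing

namespace MessagePassing

/-! ### One player against the rest, and the hard distribution for many players. -/

section Rectangles

open Finset Function
open scoped BigOperators

variable {r : ℕ} {κ Z : Type*}

section Kernel

-- A leaf reachable from `x` and reachable from `(y, z)` is reached at `(x, y, z)` by the rectangle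
-- property, so its indicator factors.
open scoped Classical in
lemma rectangle_mul_eq {leaf : Cube r → Cube r → Z → κ}
    (hrect : ∀ x y z x' y' z', leaf x y z = leaf x' y' z' → leaf x y' z' = leaf x' y' z')
    (l : κ) (x y : Cube r) (z : Z) :
    (if ∃ y z, leaf x y z = l then (1 : ℝ) else 0) * (if ∃ x, leaf x y z = l then 1 else 0)
      = if leaf x y z = l then 1 else 0 := by
  by_cases h : leaf x y z = l
  · rw [if_pos ⟨y, z, h⟩, if_pos ⟨x, h⟩, if_pos h, one_mul]
  · rw [if_neg h]
    by_contra hne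
    have h1 : ∃ y z, leaf x y z = l := by by_contra h1; simp [h1] at hne
    have h2 : ∃ x, leaf x y z = l := by by_contra h2; simp [h2] at hne
    obtain ⟨y', z', h1⟩ := h1
    obtain ⟨x', h2⟩ := h2
    exact h ((hrect _ _ _ _ _ _ (h1.trans h2.symm)).trans h2)

variable [Fintype Z]

open scoped Classical in
/-- The leaf bound for leaves of a function with the rectangle property, where the second party
holds `y` and some `z` drawn from the kernel `ζ y`. -/
theorem sum_expect_kernel_sub_le {leaf : Cube r → Cube r → Z → κ}
    (hrect : ∀ x y z x' y' z', leaf x y z = leaf x' y' z' → leaf x y' z' = leaf x' y' z')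
    {ζ : Cube r → Z → ℝ} (hζ : ∀ y z, 0 ≤ ζ y z) (hζ1 : ∀ y, ∑ z, ζ y z = 1)
    {q : κ → ℝ} (hq : ∀ l, 0 < q l) (hq1 : ∀ Λ : Finset κ, ∑ l ∈ Λ, q l ≤ 1) (O : κ → Prop) :
    ∑ j, 𝔼 d, 𝔼 u, 𝔼 u',
      ((∑ z, ζ (update (mask (compl d) u') j false) z *
        if O (leaf (update (mask d u) j false) (update (mask (compl d) u') j false) z)
          then 1 else 0)
      - ∑ z, ζ (update (mask (compl d) u') j true) z *
        if O (leaf (update (mask d u) j true) (update (mask (compl d) u') j true) z)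
          then 1 else 0)
      ≤ r / 12 + 192 * 𝔼 d, 𝔼 u, 𝔼 u', ∑ z, ζ (mask (compl d) u') z *
          -Real.log (q (leaf (mask d u) (mask (compl d) u') z)) := by
  set Λ : Finset κ := univ.image fun w : Cube r × Cube r × Z => leaf w.1 w.2.1 w.2.2 with hΛ
  have hmem : ∀ x y z, leaf x y z ∈ Λ := fun x y z =>
    mem_image.2 ⟨(x, y, z), mem_univ _, rfl⟩
  -- `a` is the factor of the single player; `b` averages the other factor over the kernel, so the
  -- extra randomness of the second party disappears and a two-party product structure remains.
  set a : κ → Cube r → ℝ := fun l x => if ∃ y z, leaf x y z = l then 1 else 0 with ha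
  set b : κ → Cube r → ℝ := fun l y => ∑ z, ζ y z * if ∃ x, leaf x y z = l then 1 else 0 with hb
  have hmul : ∀ l x y, a l x * b l y = ∑ z, ζ y z * if leaf x y z = l then 1 else 0 := by
    intro l x y
    rw [ha, hb, mul_sum]
    refine sum_congr rfl fun z _ => ?_
    rw [← rectangle_mul_eq hrect l x y z]
    dsimp only
    rw [mul_left_comm]
    congr!
  have hsum : ∀ (φ : κ → ℝ) x y, ∑ l ∈ Λ, a l x * b l y * φ l = ∑ z, ζ y z * φ (leaf x y z) := by
    intro φ x y
    simp_rw [hmul, sum_mul]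
    rw [sum_comm]
    refine sum_congr rfl fun z _ => ?_
    rw [sum_eq_single_of_mem _ (hmem x y z)]
    · simp
    · intro l _ hl
      simp [hl.symm]
  have ha0 : ∀ l u, 0 ≤ a l u := fun l u => by rw [ha]; dsimp only; split_ifs <;> norm_num
  have ha1 : ∀ l u, a l u ≤ 1 := fun l u => by rw [ha]; dsimp only; split_ifs <;> norm_num
  have hb0 : ∀ l u, 0 ≤ b l u := fun l u =>
    sum_nonneg fun z _ => mul_nonneg (hζ u z) (by split_ifs <;> norm_num)
  have hb1 : ∀ l u, b l u ≤ 1 := fun l u => by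
    rw [← hζ1 u]
    exact sum_le_sum fun z _ => mul_le_of_le_one_right (hζ u z) (by split_ifs <;> norm_num)
  have hab : ∀ x y, ∑ l ∈ Λ, a l x * b l y = 1 := fun x y => by
    have := hsum (fun _ => 1) x y
    simpa [hζ1] using this
  have main := sum_expect_leafProb_sub_le ha0 ha1 hb0 hb1 hab hq (hq1 Λ) (filter_subset O Λ)
  have hL : ∀ (d : Cube r) (j : Fin r) (c : Bool), ∑ l ∈ Λ with O l, leafProb a b d j c c l
      = 𝔼 u, 𝔼 u', ∑ z, ζ (update (mask (compl d) u') j c) z *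
        if O (leaf (update (mask d u) j c) (update (mask (compl d) u') j c) z)
          then 1 else 0 := by
    intro d j c
    unfold leafProb sliceMean
    simp_rw [expect_mul_expect_compl]
    rw [sum_filter]
    have hite : ∀ l, (if O l then 𝔼 u, 𝔼 u', a l (update (mask d u) j c) *
          b l (update (mask (compl d) u') j c) else 0)
        = 𝔼 u, 𝔼 u', a l (update (mask d u) j c) * b l (update (mask (compl d) u') j c) *
          if O l then 1 else 0 := by
      intro l; split_ifs <;> simp
    simp_rw [hite, ← expect_sum_comm]
    simp_rw [hsum]
  have hR : ∀ d : Cube r, ∑ l ∈ Λ, subcubeMean (a l) d * subcubeMean (b l) (compl d) *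
        -Real.log (q l)
      = 𝔼 u, 𝔼 u', ∑ z, ζ (mask (compl d) u') z *
          -Real.log (q (leaf (mask d u) (mask (compl d) u') z)) := by
    intro d
    unfold subcubeMean
    simp_rw [expect_mul_expect_compl, expect_mul, ← expect_sum_comm, hsum]
  simp_rw [sum_sub_distrib, hL, hR] at main
  simp_rw [expect_sub_distrib] at main ⊢
  exact main

end Kernel

section Law

open scoped Classical in
/-- The joint law of the masked pair. -/
noncomputable def pairLaw (x y : Cube r) : ℝ :=
  𝔼 d, 𝔼 u, 𝔼 u', if mask d u = x ∧ mask (compl d) u' = y then 1 else 0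

/-- The law of the second component of the masked pair. -/
noncomputable def sndLaw (y : Cube r) : ℝ := ∑ x, pairLaw x y

/-- The law of the first component of the masked pair given the second. -/
noncomputable def condLaw (y x : Cube r) : ℝ := pairLaw x y / sndLaw y

/-- The law of conditionally independent first components given the second. -/
noncomputable def condPi {K : ℕ} (y : Cube r) (z : Fin K → Cube r) : ℝ := ∏ i, condLaw y (z i)

lemma pairLaw_nonneg (x y : Cube r) : 0 ≤ pairLaw x y :=
  expect_nonneg fun _ _ => expect_nonneg fun _ _ => expect_nonneg fun _ _ => by
    split_ifs <;> norm_num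

lemma sndLaw_pos (y : Cube r) : 0 < sndLaw y := by
  refine sum_pos' (fun x _ => pairLaw_nonneg x y) ⟨fun _ => false, mem_univ _, ?_⟩
  refine expect_pos' (fun d _ => expect_nonneg fun _ _ => expect_nonneg fun _ _ => ?_)
    ⟨fun _ => false, mem_univ _, expect_pos' (fun u _ => expect_nonneg fun _ _ => ?_)
      ⟨y, mem_univ _, expect_pos' (fun u' _ => ?_) ⟨y, mem_univ _, ?_⟩⟩⟩
  · split_ifs <;> norm_num
  · split_ifs <;> norm_num
  · split_ifs <;> norm_num
  · rw [if_pos]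
    · norm_num
    · constructor <;> ext j <;> simp [mask, compl]

lemma expect_mask_eq_sum (F : Cube r → Cube r → ℝ) :
    𝔼 d, 𝔼 u, 𝔼 u', F (mask d u) (mask (compl d) u') = ∑ y, ∑ x, pairLaw x y * F x y := by
  classical
  unfold pairLaw
  simp_rw [expect_mul, ← expect_sum_comm]
  refine expect_congr rfl fun d _ => expect_congr rfl fun u _ => expect_congr rfl fun u' _ => ?_
  rw [sum_eq_single (mask (compl d) u'), sum_eq_single (mask d u)]
  · simp
  · intro x _ hx; simp [hx.symm]
  · simp
  · intro y _ hy; simp [hy.symm]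
  · simp

lemma condLaw_nonneg (y x : Cube r) : 0 ≤ condLaw y x :=
  div_nonneg (pairLaw_nonneg _ _) (sndLaw_pos _).le

lemma sum_condLaw (y : Cube r) : ∑ x, condLaw y x = 1 := by
  unfold condLaw
  rw [← sum_div]
  exact div_self (sndLaw_pos y).ne'

lemma sndLaw_mul_condLaw (y x : Cube r) : sndLaw y * condLaw y x = pairLaw x y :=
  mul_div_cancel₀ _ (sndLaw_pos y).ne'

lemma sum_sndLaw : ∑ y : Cube r, sndLaw y = 1 := by
  have := expect_mask_eq_sum (r := r) fun _ _ => 1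
  simpa [sndLaw] using this.symm

lemma disjoint_of_condLaw_ne_zero {y x : Cube r} (h : condLaw y x ≠ 0) (j : Fin r) :
    ¬(x j = true ∧ y j = true) := by
  have h1 : pairLaw x y ≠ 0 := fun h0 => h (by simp [condLaw, h0])
  obtain ⟨d, _, h2⟩ := exists_ne_zero_of_expect_ne_zero h1
  obtain ⟨u, _, h3⟩ := exists_ne_zero_of_expect_ne_zero h2
  obtain ⟨u', _, h4⟩ := exists_ne_zero_of_expect_ne_zero h3
  split_ifs at h4 with h5
  · obtain ⟨rfl, rfl⟩ := h5
    cases hd : d j <;> simp [mask, compl, hd]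
  · exact absurd rfl h4

variable {K : ℕ}

lemma condPi_nonneg (y : Cube r) (z : Fin K → Cube r) : 0 ≤ condPi y z :=
  prod_nonneg fun _ _ => condLaw_nonneg _ _

lemma sum_condPi (y : Cube r) : ∑ z : Fin K → Cube r, condPi y z = 1 := by
  have := Finset.prod_univ_sum (fun _ : Fin K => (univ : Finset (Cube r)))
    (fun _ x => condLaw y x)
  rw [Fintype.piFinset_univ] at this
  unfold condPi
  rw [← this]
  simp [sum_condLaw]

lemma disjoint_of_condPi_ne_zero {y : Cube r} {z : Fin K → Cube r} (h : condPi y z ≠ 0)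
    (i : Fin K) (j : Fin r) : ¬(z i j = true ∧ y j = true) :=
  disjoint_of_condLaw_ne_zero (prod_ne_zero_iff.1 h i (mem_univ _)) j

/-- Detailed balance: the weight of an independent draw of `x` and `z` is symmetric under exchanging
`x` with `z i`. -/
lemma condLaw_mul_condPi_update (y x : Cube r) (z : Fin K → Cube r) (i : Fin K) :
    condLaw y (z i) * condPi y (update z i x) = condLaw y x * condPi y z := by
  unfold condPi
  rw [← mul_prod_erase univ (fun i' => condLaw y (z i')) (mem_univ i),
    ← mul_prod_erase univ (fun i' => condLaw y (update z i x i')) (mem_univ i), update_self]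
  have : ∏ i' ∈ univ.erase i, condLaw y (update z i x i') = ∏ i' ∈ univ.erase i, condLaw y (z i') :=
    prod_congr rfl fun i' hi' => by rw [update_of_ne (ne_of_mem_erase hi')]
  rw [this]; ring

/-- Resampling one component does not change the law. -/
lemma sum_condLaw_update (y : Cube r) (i : Fin K) (G : (Fin K → Cube r) → ℝ) :
    ∑ x, condLaw y x * ∑ z, condPi y z * G (update z i x) = ∑ z, condPi y z * G z := by
  have hinv : Involutive fun w : Cube r × (Fin K → Cube r) => (w.2 i, update w.2 i w.1) := by
    intro w; simp
  calc ∑ x, condLaw y x * ∑ z, condPi y z * G (update z i x)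
      = ∑ w : Cube r × (Fin K → Cube r),
          condLaw y w.1 * condPi y w.2 * G (update w.2 i w.1) := by
        simp_rw [mul_sum, ← mul_assoc]; rw [Fintype.sum_prod_type]
    _ = ∑ w : Cube r × (Fin K → Cube r), condLaw y w.1 * condPi y w.2 * G w.2 := by
        refine Fintype.sum_equiv (hinv.toPerm _) _ _ fun w => ?_
        simp [condLaw_mul_condPi_update]
    _ = _ := by
        rw [Fintype.sum_prod_type]
        simp_rw [mul_assoc, ← mul_sum, ← sum_mul, sum_condLaw, one_mul]

/-- Without planting, the distinguished player is just another conditionally independent copy. The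
resulting law does not depend on `i`, so the costs of all players can be added under one
distribution. -/
lemma expect_condPi_update (i : Fin K) (G : Cube r → (Fin K → Cube r) → ℝ) :
    𝔼 d, 𝔼 u, 𝔼 u', ∑ z, condPi (mask (compl d) u') z *
        G (mask (compl d) u') (update z i (mask d u))
      = ∑ y, sndLaw y * ∑ z, condPi y z * G y z := by
  rw [expect_mask_eq_sum fun x y => ∑ z, condPi y z * G y (update z i x)]
  refine sum_congr rfl fun y _ => ?_
  rw [← sum_condLaw_update y i, mul_sum]
  refine sum_congr rfl fun x _ => ?_
  rw [← sndLaw_mul_condLaw, mul_assoc]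

/-- The probability of the event `O` when the bits of player `i` and of the common party at a
random coordinate are set to `c` and all other crossings are excluded. -/
noncomputable def plantedProb (K : ℕ) (O : Cube r → (Fin K → Cube r) → ℝ) (c : Bool) : ℝ :=
  ∑ i : Fin K, ∑ j, 𝔼 d, 𝔼 u, 𝔼 u', ∑ z, condPi (update (mask (compl d) u') j c) z *
    O (update (mask (compl d) u') j c) (update z i (update (mask d u) j c))

open scoped Classical in
/-- If every player's view is cheap, then the planted and the unplanted distribution are close. -/
theorem plantedProb_sub_le (lf : Fin K → Cube r → (Fin K → Cube r) → κ)
    (hrect : ∀ i y z y' z', lf i y z = lf i y' z' → lf i y' (update z' i (z i)) = lf i y' z')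
    {q : κ → ℝ} (hq : ∀ l, 0 < q l) (hq1 : ∀ Λ : Finset κ, ∑ l ∈ Λ, q l ≤ 1)
    (O : κ → Prop) (D : Cube r → (Fin K → Cube r) → Prop) (hD : ∀ i y z, O (lf i y z) ↔ D y z)
    (T : ℝ) (hT : ∀ y z, ∑ i, -Real.log (q (lf i y z)) ≤ T) :
    plantedProb K (fun y z => if D y z then 1 else 0) false
      - plantedProb K (fun y z => if D y z then 1 else 0) true ≤ K * r / 12 + 192 * T := by
  have key : ∀ i : Fin K, _ := fun i => sum_expect_kernel_sub_le
    (leaf := fun x y z => lf i y (update z i x))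
    (fun x y z x' y' z' h => by simpa using hrect i _ _ _ _ h)
    (ζ := condPi) condPi_nonneg sum_condPi hq hq1 O
  -- All `K` entropy terms now refer to the same law, where the pointwise bound `T` on their sum
  -- applies.
  have hlaw := fun i => expect_condPi_update i fun y z => -Real.log (q (lf i y z))
  simp_rw [hlaw, hD, expect_sub_distrib, sum_sub_distrib] at key
  have hs := sum_le_sum (s := univ) fun i _ => key i
  rw [sum_sub_distrib] at hs
  refine hs.trans ?_
  rw [sum_add_distrib, ← mul_sum, sum_const, card_univ, Fintype.card_fin, nsmul_eq_mul,
    mul_div_assoc]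
  gcongr
  rw [sum_comm]
  simp_rw [← mul_sum]
  calc ∑ y : Cube r, sndLaw y * ∑ i, ∑ z, condPi y z * -Real.log (q (lf i y z))
      = ∑ y : Cube r, sndLaw y * ∑ z, condPi y z * ∑ i, -Real.log (q (lf i y z)) := by
        refine sum_congr rfl fun y _ => ?_
        rw [sum_comm]; simp_rw [mul_sum]
    _ ≤ ∑ y : Cube r, sndLaw y * ∑ z : Fin K → Cube r, condPi y z * T := by
        refine sum_le_sum fun y _ => mul_le_mul_of_nonneg_left ?_ (sndLaw_pos y).le
        exact sum_le_sum fun z _ => mul_le_mul_of_nonneg_left (hT y z) (condPi_nonneg y z)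
    _ = T := by simp_rw [← sum_mul, sum_condPi, one_mul, ← sum_mul, sum_sndLaw, one_mul]

end Law

end Rectangles

end MessagePassing

namespace MessagePassing

/-! ### A Kraft inequality for transcripts, and the total length of the views. -/

section Kraft

open Finset

/-- The weight of a word is that of its first letter times that of its tail; enlarging the set to
all combinations of occurring heads and tails factors the sum. -/
lemma sum_prod_map_cons_le {M : Type*} {w : M → ℝ} (hw : ∀ m, 0 ≤ w m) {A B : ℝ} (hA : 0 ≤ A)
    (h1 : ∀ S : Finset M, ∑ m ∈ S, w m ≤ A) (S : Finset (List M)) (hS : ∀ l ∈ S, l ≠ [])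
    (h2 : ∀ S' : Finset (List M), (∀ l ∈ S', ∃ m, m :: l ∈ S) →
      ∑ l ∈ S', (l.map w).prod ≤ B) :
    ∑ l ∈ S, (l.map w).prod ≤ A * B := by
  classical
  have hnn : ∀ l : List M, 0 ≤ (l.map w).prod := fun l =>
    List.prod_nonneg fun x hx => by
      obtain ⟨m, _, rfl⟩ := List.mem_map.1 hx
      exact hw m
  have hinj : Function.Injective fun p : M × List M => p.1 :: p.2 := by
    intro p p' h; simpa [Prod.ext_iff] using h
  obtain ⟨R, hR⟩ : ∃ R : Finset (M × List M), ∀ p, p ∈ R ↔ p.1 :: p.2 ∈ S :=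
    ⟨S.preimage _ hinj.injOn, fun p => mem_preimage⟩
  have hSR : S ⊆ R.image fun p => p.1 :: p.2 := by
    intro l hl
    obtain ⟨m, l', rfl⟩ := List.exists_cons_of_ne_nil (hS l hl)
    exact mem_image.2 ⟨(m, l'), (hR (m, l')).2 hl, rfl⟩
  calc ∑ l ∈ S, (l.map w).prod
      ≤ ∑ l ∈ R.image fun p => p.1 :: p.2, (l.map w).prod :=
        sum_le_sum_of_subset_of_nonneg hSR fun l _ _ => hnn l
    _ = ∑ p ∈ R, w p.1 * (p.2.map w).prod := by
        rw [sum_image hinj.injOn]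
        simp
    _ ≤ ∑ p ∈ R.image Prod.fst ×ˢ R.image Prod.snd, w p.1 * (p.2.map w).prod :=
        sum_le_sum_of_subset_of_nonneg
          (fun p hp => mem_product.2 ⟨mem_image_of_mem _ hp, mem_image_of_mem _ hp⟩)
          fun p _ _ => mul_nonneg (hw _) (hnn _)
    _ = (∑ m ∈ R.image Prod.fst, w m) * ∑ l ∈ R.image Prod.snd, (l.map w).prod := by
        rw [sum_product, sum_mul_sum]
    _ ≤ A * B := by
        refine mul_le_mul (h1 _) (h2 _ ?_) (sum_nonneg fun l _ => hnn l) hA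
        intro l hl
        obtain ⟨p, hp, rfl⟩ := mem_image.1 hl
        exact ⟨p.1, (hR p).1 hp⟩

/-- If the weights of the letters sum to at most `1 / 2`, then the weights of the words sum to at
most `2`. -/
lemma sum_prod_map_le_two {M : Type*} {w : M → ℝ} (hw : ∀ m, 0 ≤ w m)
    (h1 : ∀ S : Finset M, ∑ m ∈ S, w m ≤ 1 / 2) (S : Finset (List M)) :
    ∑ l ∈ S, (l.map w).prod ≤ 2 := by
  classical
  have key : ∀ (N : ℕ) (S : Finset (List M)), (∀ l ∈ S, l.length < N) →
      ∑ l ∈ S, (l.map w).prod ≤ 2 := by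
    intro N
    induction N with
    | zero =>
      intro S hS
      have : S = ∅ := eq_empty_of_forall_notMem fun l hl => by simpa using hS l hl
      simp [this]
    | succ N ih =>
      intro S hS
      have h3 : ∑ l ∈ S.filter (· ≠ []), (l.map w).prod ≤ 1 / 2 * 2 := by
        refine sum_prod_map_cons_le hw (by norm_num) h1 _ (fun l hl => (mem_filter.1 hl).2) ?_
        intro S' hS'
        refine ih S' fun l hl => ?_
        obtain ⟨m, hm⟩ := hS' l hl
        have := hS _ (mem_filter.1 hm).1
        simpa using this
      have h4 : ∑ l ∈ S.filter (¬ · ≠ []), (l.map w).prod ≤ 1 := by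
        have : S.filter (¬ · ≠ []) ⊆ {[]} := fun l hl => by
          simpa using (mem_filter.1 hl).2
        calc _ ≤ ∑ l ∈ {([] : List M)}, (l.map w).prod :=
              sum_le_sum_of_subset_of_nonneg this fun l hl _ => by
                rw [mem_singleton.1 hl]; simp
          _ = 1 := by simp
      rw [← sum_filter_add_sum_filter_not S (· ≠ [])]
      linarith
  refine key (S.sup List.length + 1) S fun l hl => ?_
  exact Nat.lt_succ_of_le (le_sup (f := List.length) hl)

variable {k : ℕ}

lemma pow_cost_eq_prod (z : ℝ) (t : Transcript k) :
    z ^ t.cost = (t.map fun m => z ^ m.bits.1.length).prod := by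
  induction t with
  | nil => simp [Transcript.cost]
  | cons m t ih =>
    rw [List.map_cons, List.prod_cons, ← ih, ← pow_add]
    simp [Transcript.cost]

lemma pow_length_eq_prod (z : ℝ) (l : List Bool) : z ^ l.length = (l.map fun _ => z).prod := by
  simp

/-- A Kraft inequality for transcripts. -/
lemma sum_pow_cost_le_two (hk : 0 < k) (S : Finset (Transcript k)) :
    ∑ t ∈ S, ((1 : ℝ) / (8 * k ^ 2)) ^ t.cost ≤ 2 := by
  classical
  -- Nonempty bit strings have total weight at most `4 * z`, and there are `k ^ 2` pairs of sender
  -- and recipient, so this value makes the weight of all messages at most `1 / 2`.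
  set z : ℝ := 1 / (8 * k ^ 2) with hz
  have hk' : (1 : ℝ) ≤ k := by exact_mod_cast hk
  have hz0 : 0 ≤ z := by positivity
  have hz1 : z ≤ 1 / 8 := by
    rw [hz]
    apply one_div_le_one_div_of_le (by norm_num)
    nlinarith
  simp_rw [pow_cost_eq_prod]
  refine sum_prod_map_le_two (fun m => by positivity) (fun S => ?_) S
  have hbool : ∀ S : Finset Bool, ∑ _m ∈ S, z ≤ 2 * z := by
    intro S
    rw [sum_const, nsmul_eq_mul]
    gcongr
    exact_mod_cast card_le_univ S
  have hbits : ∀ B : Finset (List Bool), (∀ l ∈ B, l ≠ []) →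
      ∑ l ∈ B, z ^ l.length ≤ 2 * z * 2 := by
    intro B hB
    simp_rw [pow_length_eq_prod]
    refine sum_prod_map_cons_le (fun _ => hz0) (by positivity) hbool B hB fun S' _ => ?_
    refine sum_prod_map_le_two (fun _ => hz0) (fun S => (hbool S).trans ?_) S'
    linarith
  set φ : Message k → Fin k × Fin k × List Bool := fun m => (m.src, m.dst, m.bits.1) with hφ
  have hφi : Function.Injective φ := by
    rintro ⟨s, d, ⟨b, hb⟩⟩ ⟨s', d', ⟨b', hb'⟩⟩ h
    simp [hφ] at h
    obtain ⟨rfl, rfl, rfl⟩ := h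
    rfl
  set B := S.image fun m => m.bits.1 with hB
  calc ∑ m ∈ S, z ^ m.bits.1.length
      = ∑ p ∈ S.image φ, z ^ p.2.2.length := by rw [sum_image (fun _ _ _ _ h => hφi h)]
    _ ≤ ∑ p ∈ (univ : Finset (Fin k)) ×ˢ (univ : Finset (Fin k)) ×ˢ B, z ^ p.2.2.length := by
        refine sum_le_sum_of_subset_of_nonneg ?_ fun _ _ _ => by positivity
        intro p hp
        obtain ⟨m, hm, rfl⟩ := mem_image.1 hp
        simp only [mem_product, mem_univ, true_and]
        exact mem_image_of_mem _ hm
    _ = k * (k * ∑ l ∈ B, z ^ l.length) := by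
        rw [sum_product]; simp [sum_product]
    _ ≤ k * (k * (2 * z * 2)) := by
        gcongr
        refine hbits B fun l hl => ?_
        obtain ⟨m, _, rfl⟩ := mem_image.1 hl
        exact m.bits.2
    _ = 1 / 2 := by rw [hz]; field_simp; norm_num

lemma cost_cons (m : Message k) (t : Transcript k) :
    Transcript.cost (m :: t) = m.bits.1.length + Transcript.cost t := by
  simp [Transcript.cost]

lemma view_singleton (m : Message k) (i : Fin k) :
    Transcript.view [m] i = if m.src = i ∨ m.dst = i then [m] else [] := by
  unfold Transcript.view
  split_ifs with h <;> simp [h]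

/-- A message is seen by its sender and its recipient only. -/
lemma sum_cost_view_le (t : Transcript k) : ∑ s, (t.view s).cost ≤ 2 * t.cost := by
  induction t with
  | nil => simp [Transcript.view, Transcript.cost]
  | cons m t ih =>
    have h : ∀ s, Transcript.cost (Transcript.view (m :: t) s) ≤
        (if m.src = s then m.bits.1.length else 0) + (if m.dst = s then m.bits.1.length else 0)
          + (Transcript.view t s).cost := by
      intro s
      unfold Transcript.view
      rw [List.filter_cons]
      by_cases h1 : m.src = s <;> by_cases h2 : m.dst = s <;> simp [h1, h2, cost_cons]
    calc _ ≤ ∑ s, ((if m.src = s then m.bits.1.length else 0)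
          + (if m.dst = s then m.bits.1.length else 0) + (Transcript.view t s).cost) :=
          sum_le_sum fun s _ => h s
      _ = m.bits.1.length + m.bits.1.length + ∑ s, (Transcript.view t s).cost := by
          simp [sum_add_distrib]
      _ ≤ _ := by rw [cost_cons]; omega

end Kraft

/-! ### Executions of protocols and their rectangle property. -/

namespace Protocol

variable {k : ℕ} {X β : Type} (P : Protocol k X β)

lemma prefix_next (x : Fin k → X) (t : Transcript k) : t <+: P.next x t := by
  unfold next
  split
  · exact List.prefix_append _ _
  · exact List.prefix_refl _

lemma next_of_report {x : Fin k → X} {t : Transcript k} {i : Fin k} (h : P.turn t = .report i) :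
    P.next x t = t := by
  simp [next, h]

lemma iterate_of_report {x : Fin k → X} {t : Transcript k} {i : Fin k}
    (h : P.turn t = .report i) (s : ℕ) : (P.next x)^[s] t = t :=
  Function.iterate_fixed (P.next_of_report h) s

lemma prefix_iterate (x : Fin k → X) (t : Transcript k) (s : ℕ) : t <+: (P.next x)^[s] t := by
  induction s with
  | zero => exact List.prefix_refl _
  | succ s ih =>
    rw [Function.iterate_succ_apply']
    exact ih.trans (P.prefix_next x _)

variable {P}

lemma EndsWith.iterate_prefix {x : Fin k → X} {t : Transcript k} {i : Fin k}
    (h : P.EndsWith x t i) (s : ℕ) : (P.next x)^[s] [] <+: t := by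
  obtain ⟨⟨s', hs'⟩, hrep⟩ := h
  rcases le_total s s' with hle | hle
  · obtain ⟨c, rfl⟩ := Nat.exists_eq_add_of_le hle
    rw [← hs', add_comm, Function.iterate_add_apply]
    exact P.prefix_iterate x _ c
  · obtain ⟨c, rfl⟩ := Nat.exists_eq_add_of_le hle
    rw [add_comm, Function.iterate_add_apply, hs', P.iterate_of_report hrep]

lemma EndsWith.unique {x : Fin k → X} {t t' : Transcript k} {i i' : Fin k}
    (h : P.EndsWith x t i) (h' : P.EndsWith x t' i') : t = t' ∧ i = i' := by
  have h1 : t = t' := by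
    obtain ⟨s, hs⟩ := h.1
    obtain ⟨s', hs'⟩ := h'.1
    have h1 := h'.iterate_prefix s
    have h2 := h.iterate_prefix s'
    rw [hs] at h1
    rw [hs'] at h2
    exact h1.eq_of_length_le h2.length_le
  subst h1
  have := h.2.symm.trans h'.2
  exact ⟨rfl, by simpa using this⟩

lemma view_append (t t' : Transcript k) (i : Fin k) :
    Transcript.view (t ++ t') i = t.view i ++ Transcript.view t' i :=
  List.filter_append _ _

lemma view_prefix {t t' : Transcript k} (h : t <+: t') (i : Fin k) : t.view i <+: t'.view i := by
  obtain ⟨c, rfl⟩ := h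
  rw [view_append]
  exact List.prefix_append _ _

lemma view_singleton_src (m : Message k) : Transcript.view [m] m.src = [m] := by
  simp [view_singleton]

/-- The messages sent by site `i` are determined by its input and its view. -/
lemma eq_send_of_prefix_view (x : Fin k → X) (i : Fin k) (s : ℕ) (w : Transcript k)
    (m : Message k) (hm : m.src = i) (h : w ++ [m] <+: Transcript.view ((P.next x)^[s] []) i) :
    m = ⟨i, (P.send i (x i) w).1, (P.send i (x i) w).2⟩ := by
  induction s with
  | zero => simp [Transcript.view] at h
  | succ s ih =>
    rw [Function.iterate_succ_apply'] at h
    set t := (P.next x)^[s] [] with ht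
    unfold next at h
    split at h
    · rename_i j hj
      rw [view_append] at h
      rw [view_singleton] at h
      split_ifs at h
      -- Either `m` is the message just sent, or it already occurs in the view before this turn.
      · rcases List.prefix_concat_iff.1 h with h2 | h2
        · obtain ⟨h3, h4⟩ := List.append_inj' h2 rfl
          obtain rfl : m = _ := List.singleton_inj.1 h4
          dsimp only at hm
          subst hm
          rw [h3]
        · exact ih h2
      · rw [List.append_nil] at h
        exact ih h
    · exact ih h

/-- The inputs of site `i` and of the other sites can be exchanged between executions with the same
view of site `i`. -/
lemma EndsWith.exchange {x x' x'' : Fin k → X} {t t' : Transcript k} {j j' i : Fin k}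
    (h : P.EndsWith x t j) (h' : P.EndsWith x' t' j') (hv : t.view i = t'.view i)
    (hi : x'' i = x i) (hne : ∀ s, s ≠ i → x'' s = x' s) : P.EndsWith x'' t' j' := by
  have key : ∀ s, (P.next x'')^[s] [] = (P.next x')^[s] [] := by
    intro s
    induction s with
    | zero => rfl
    | succ s ih =>
      have hpre := h'.iterate_prefix (s + 1)
      rw [Function.iterate_succ_apply'] at hpre ⊢
      rw [Function.iterate_succ_apply', ih]
      set u := (P.next x')^[s] [] with hu
      unfold next at hpre ⊢
      split
      · rename_i l hl
        simp only [hl] at hpre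
        -- If `i` speaks, its next message is part of the common view, and the first execution shows
        -- that its input in `x` sends the same message there. Any other speaker has its input from
        -- `x'`.
        by_cases hli : l = i
        · subst hli
          have h1 := view_prefix hpre l
          rw [view_append, ← hv] at h1
          obtain ⟨s', hs'⟩ := h.1
          have h2 := view_singleton_src (⟨l, (P.send l (x' l) (u.view l)).1,
            (P.send l (x' l) (u.view l)).2⟩ : Message k)
          dsimp only at h2
          rw [h2, ← hs'] at h1
          have h3 := eq_send_of_prefix_view x l s' _ _ rfl h1
          rw [h3, hi]
        · rw [hne l hli]
      · rfl
  obtain ⟨s, hs⟩ := h'.1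
  exact ⟨⟨s, by rw [key, hs]⟩, h'.2⟩

end Protocol

end MessagePassing

namespace MessagePassing

/-! ### From randomized protocols to a deterministic one on the planted distributions. -/

section Yao

open Finset Function MeasureTheory
open scoped BigOperators

/-- Averaging over the randomness: some outcome has small weighted error. -/
lemma exists_outcome {Ω ι : Type*} [MeasurableSpace Ω] (μ : Measure Ω) [IsProbabilityMeasure μ]
    [Fintype ι] (W : ι → ℝ) (hW : ∀ i, 0 ≤ W i) (A : ι → Set Ω) (hA : ∀ i, μ (A i) ≤ 1 / 3) :
    ∃ ω, ∑ i, W i * (A i).indicator 1 ω ≤ (∑ i, W i) / 3 := by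
  classical
  -- The error events need not be measurable; measurable hulls have the same outer measure.
  set F : Ω → ℝ≥0∞ := fun ω =>
    ∑ i, ENNReal.ofReal (W i) * (toMeasurable μ (A i)).indicator 1 ω with hF
  have hmeas : ∀ i, Measurable fun ω => ENNReal.ofReal (W i) *
      (toMeasurable μ (A i)).indicator (1 : Ω → ℝ≥0∞) ω := fun i =>
    (measurable_one.indicator (measurableSet_toMeasurable μ (A i))).const_mul _
  have hint : ∫⁻ ω, F ω ∂μ ≤ ENNReal.ofReal ((∑ i, W i) / 3) := by
    rw [hF, lintegral_finsetSum _ fun i _ => hmeas i, sum_div,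
      ENNReal.ofReal_sum_of_nonneg fun i _ => by have := hW i; positivity]
    refine sum_le_sum fun i _ => ?_
    rw [lintegral_const_mul _ (measurable_one.indicator (measurableSet_toMeasurable μ (A i))),
      lintegral_indicator_one (measurableSet_toMeasurable μ (A i)), measure_toMeasurable,
      div_eq_mul_one_div, ENNReal.ofReal_mul (hW i)]
    gcongr
    refine (hA i).trans ?_
    rw [ENNReal.ofReal_div_of_pos (by norm_num)]
    simp
  obtain ⟨ω, hω⟩ := exists_le_lintegral (μ := μ) (f := F)
    (Finset.measurable_sum _ fun i _ => hmeas i).aemeasurable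
  refine ⟨ω, ?_⟩
  have h1 : ENNReal.ofReal (∑ i, W i * (A i).indicator 1 ω) ≤ ENNReal.ofReal ((∑ i, W i) / 3) := by
    refine le_trans ?_ (hω.trans hint)
    rw [ENNReal.ofReal_sum_of_nonneg fun i _ => mul_nonneg (hW i)
      (Set.indicator_nonneg (f := (1 : Ω → ℝ)) (fun _ _ => zero_le_one) ω)]
    refine sum_le_sum fun i _ => ?_
    rw [ENNReal.ofReal_mul (hW i)]
    gcongr
    by_cases h : ω ∈ A i
    · simp [h, subset_toMeasurable μ (A i) h]
    · simp [h]
  have h2 : 0 ≤ (∑ i, W i) / 3 := div_nonneg (sum_nonneg fun i _ => hW i) (by norm_num)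
  exact (ENNReal.ofReal_le_ofReal_iff h2).1 h1

variable {r K : ℕ}

/-- Player `p.1` and the common party both have element `p.2`. -/
def Crossing (y : Cube r) (z : Fin K → Cube r) (p : Fin K × Fin r) : Prop :=
  z p.1 p.2 = true ∧ y p.2 = true

/-- There is no crossing (`c = false`) or exactly one (`c = true`). -/
def Promise (c : Bool) (y : Cube r) (z : Fin K → Cube r) : Prop :=
  if c then ∃! p, Crossing y z p else ∀ p, ¬ Crossing y z p

/-- The other players are drawn disjoint from the already overwritten `y`, so none of them crosses
it, at `j` or elsewhere. Away from `j`, player `i` is disjoint from `y` by the complementary masks.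
-/
lemma promise_planted (c : Bool) (d u u' : Cube r) (z : Fin K → Cube r) (i : Fin K) (j : Fin r)
    (hz : condPi (update (mask (compl d) u') j c) z ≠ 0) :
    Promise c (update (mask (compl d) u') j c) (update z i (update (mask d u) j c)) := by
  have h : ∀ p, Crossing (update (mask (compl d) u') j c) (update z i (update (mask d u) j c)) p ↔
      p = (i, j) ∧ c = true := by
    rintro ⟨i', j'⟩
    have hne := disjoint_of_condPi_ne_zero hz i' j'
    unfold Crossing
    by_cases hi : i' = i
    · subst hi
      by_cases hj : j' = j
      · subst hj; simp
      · simp only [update_self, update_of_ne hj, Prod.mk.injEq, hj, and_false, false_and,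
          iff_false]
        cases hd : d j' <;> simp [mask, compl, hd]
    · simp only [update_of_ne hi, Prod.mk.injEq, hi, false_and, iff_false]
      exact hne
  cases c
  · simpa [Promise] using fun i' j' => (h (i', j')).not.2 (by simp)
  · exact ⟨(i, j), (h _).2 ⟨rfl, rfl⟩, fun p hp => ((h p).1 hp).1⟩

lemma plantedProb_mono {O O' : Cube r → (Fin K → Cube r) → ℝ} {c : Bool}
    (h : ∀ y z, Promise c y z → O y z ≤ O' y z) : plantedProb K O c ≤ plantedProb K O' c := by
  refine sum_le_sum fun i _ => sum_le_sum fun j _ => expect_le_expect fun d _ =>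
    expect_le_expect fun u _ => expect_le_expect fun u' _ => sum_le_sum fun z _ => ?_
  by_cases hz : condPi (update (mask (compl d) u') j c) z = 0
  · simp [hz]
  · exact mul_le_mul_of_nonneg_left (h _ _ (promise_planted c d u u' z i j hz))
      (condPi_nonneg _ _)

lemma plantedProb_one (c : Bool) : plantedProb (r := r) K (fun _ _ => 1) c = K * r := by
  unfold plantedProb
  simp [sum_condPi]

lemma plantedProb_sub (O O' : Cube r → (Fin K → Cube r) → ℝ) (c : Bool) :
    plantedProb K (fun y z => O y z - O' y z) c = plantedProb K O c - plantedProb K O' c := by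
  unfold plantedProb
  simp_rw [mul_sub, sum_sub_distrib, expect_sub_distrib, sum_sub_distrib]

open scoped Classical in
/-- The probability of a single input in the planted distribution. -/
noncomputable def plantedWeight (c : Bool) (w : Cube r × (Fin K → Cube r)) : ℝ :=
  plantedProb K (fun y z => if (y, z) = w then 1 else 0) c

lemma plantedWeight_nonneg (c : Bool) (w : Cube r × (Fin K → Cube r)) : 0 ≤ plantedWeight c w := by
  unfold plantedWeight plantedProb
  refine sum_nonneg fun _ _ => sum_nonneg fun _ _ => expect_nonneg fun _ _ =>
    expect_nonneg fun _ _ => expect_nonneg fun _ _ => sum_nonneg fun _ _ =>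
      mul_nonneg (condPi_nonneg _ _) ?_
  dsimp only
  split_ifs <;> norm_num

lemma plantedProb_eq_sum (O : Cube r → (Fin K → Cube r) → ℝ) (c : Bool) :
    plantedProb K O c = ∑ w, plantedWeight c w * O w.1 w.2 := by
  classical
  unfold plantedWeight plantedProb
  simp_rw [sum_mul, expect_mul, sum_mul]
  conv_rhs => rw [sum_comm]
  refine sum_congr rfl fun i _ => ?_
  conv_rhs => rw [sum_comm]
  refine sum_congr rfl fun j _ => ?_
  simp_rw [← expect_sum_comm]
  refine expect_congr rfl fun d _ => expect_congr rfl fun u _ => expect_congr rfl fun u' _ => ?_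
  conv_rhs => rw [sum_comm]
  refine sum_congr rfl fun z _ => ?_
  rw [sum_eq_single (update (mask (compl d) u') j c, update z i (update (mask d u) j c))]
  · simp
  · intro w _ hw
    simp [hw.symm]
  · simp

end Yao

/-! ### The lower bound for disjointness. -/

section Core

open Finset Function MeasureTheory

variable {k K r : ℕ} {X : Type}

/-- The inputs of the common party (`none`) and of the players. -/
def joinInputs (y : Cube r) (z : Fin K → Cube r) : Option (Fin K) → Cube r := fun o => o.elim y z

open scoped Classical in
/-- A deterministic protocol of cost at most `b` hardly distinguishes the planted from the unplanted
distribution. -/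
theorem plantedProb_outputs_sub_le (hk : 0 < k) (site : Option (Fin K) → Fin k)
    (hsite : Injective site) (enc : (Option (Fin K) → Cube r) → Fin k → X)
    (henc : ∀ D D' s, (∀ o, site o = s → D o = D' o) → enc D s = enc D' s)
    (P : Protocol k X Prop) (b : ℕ) (hb : ∀ D, P.CostAtMost (enc D) b) :
    plantedProb (r := r) K (fun y z => if P.Outputs (enc (joinInputs y z)) False then 1 else 0) false
      - plantedProb (r := r) K
        (fun y z => if P.Outputs (enc (joinInputs y z)) False then 1 else 0) true
      ≤ K * r / 12 + 192 * (K * Real.log 8 + 2 * b * Real.log (8 * k ^ 2)) := by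
  choose tr rep hend hcost using hb
  set out : (Option (Fin K) → Cube r) → Prop := fun D =>
    P.answer (rep D) (enc D (rep D)) ((tr D).view (rep D)) = False with hout
  have hiff : ∀ D, P.Outputs (enc D) False ↔ out D := by
    intro D
    constructor
    · rintro ⟨t, i, h1, h2⟩
      obtain ⟨rfl, rfl⟩ := h1.unique (hend D)
      exact h2
    · intro h
      exact ⟨_, _, hend D, h⟩
  have hk' : (0 : ℝ) < k := by exact_mod_cast hk
  set ζ : ℝ := 1 / (8 * k ^ 2) with hζ
  have hζ0 : 0 < ζ := by positivity
  -- Besides the view, a leaf records whether the player's site reports and whether the answer is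
  -- `False`; both are needed for the answer to be a function of the leaf with the rectangle
  -- property.
  set lf : Fin K → Cube r → (Fin K → Cube r) → Transcript k × Bool × Bool := fun i y z =>
    ((tr (joinInputs y z)).view (site (some i)),
      decide (rep (joinInputs y z) = site (some i)), decide (out (joinInputs y z))) with hlf
  -- Transcript weights sum to at most 2 and there are four pairs of flags, hence the division by 8.
  refine plantedProb_sub_le lf ?_ (q := fun l => ζ ^ Transcript.cost l.1 / 8)
    (fun l => by positivity) ?_ (fun l => l.2.2 = true)
    (fun y z => P.Outputs (enc (joinInputs y z)) False)
    (fun i y z => by simp only [hlf, hiff, decide_eq_true_eq]) _ ?_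
  · intro i y z y' z' h
    simp only [hlf, Prod.mk.injEq, decide_eq_decide] at h
    obtain ⟨hv, hr, ho⟩ := h
    set D := joinInputs y z with hD
    set D' := joinInputs y' z' with hD'
    set D'' := joinInputs y' (update z' i (z i)) with hD''
    have hi : enc D'' (site (some i)) = enc D (site (some i)) := by
      refine henc _ _ _ fun o ho' => ?_
      rw [hsite ho']
      simp [hD'', hD, joinInputs]
    have hne : ∀ s, s ≠ site (some i) → enc D'' s = enc D' s := by
      intro s hs
      refine henc _ _ _ fun o ho' => ?_
      rcases o with _ | i'
      · rfl
      · have : i' ≠ i := by rintro rfl; exact hs ho'.symm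
        simp [hD'', hD', joinInputs, this]
    have hex := (hend D).exchange (hend D') hv hi hne
    obtain ⟨ht, hrp⟩ := (hend D'').unique hex
    have ho'' : out D'' ↔ out D' := by
      -- If the site of player `i` reports, its input and view agree with those in `D`, where it
      -- also reports. Otherwise the reporter's input is that of `D'`.
      by_cases hc : rep D' = site (some i)
      · rw [← ho]
        simp only [hout]
        rw [ht, hrp, hc, hr.2 hc, hi, hv]
      · simp only [hout]
        rw [ht, hrp, hne _ hc]
    simp only [hlf, Prod.mk.injEq, decide_eq_decide]
    exact ⟨by rw [← hD'', ← hD', ht], by rw [← hD'', ← hD', hrp], ho''⟩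
  · intro Λ
    calc ∑ l ∈ Λ, ζ ^ Transcript.cost l.1 / 8
        ≤ ∑ l ∈ Λ.image Prod.fst ×ˢ (univ : Finset (Bool × Bool)), ζ ^ Transcript.cost l.1 / 8 :=
          sum_le_sum_of_subset_of_nonneg
            (fun l hl => mem_product.2 ⟨mem_image_of_mem _ hl, mem_univ _⟩)
            fun _ _ _ => by positivity
      _ = (∑ t ∈ Λ.image Prod.fst, ζ ^ Transcript.cost t) / 2 := by
          rw [sum_product, sum_div]
          refine sum_congr rfl fun t _ => ?_
          simp
          ring
      _ ≤ 2 / 2 := by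
          gcongr
          exact sum_pow_cost_le_two hk _
      _ = 1 := by norm_num
  · intro y z
    have hlog : ∀ i, -Real.log (ζ ^ Transcript.cost (lf i y z).1 / 8)
        = Real.log 8 + ((tr (joinInputs y z)).view (site (some i))).cost *
          Real.log (8 * k ^ 2) := by
      intro i
      rw [Real.log_div (by positivity) (by norm_num), Real.log_pow, hζ, Real.log_div (by norm_num)
        (by positivity), Real.log_one]
      ring
    simp_rw [hlog]
    rw [sum_add_distrib, ← sum_mul]
    have hL : 0 ≤ Real.log (8 * k ^ 2) := by
      apply Real.log_nonneg
      have : (1 : ℝ) ≤ k := by exact_mod_cast hk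
      nlinarith
    have hs : ∑ i : Fin K, ((tr (joinInputs y z)).view (site (some i))).cost ≤ 2 * b := by
      calc _ = ∑ s ∈ univ.image fun i : Fin K => site (some i),
            ((tr (joinInputs y z)).view s).cost := by
            rw [sum_image fun _ _ _ _ h => Option.some_injective _ (hsite h)]
        _ ≤ ∑ s, ((tr (joinInputs y z)).view s).cost :=
            sum_le_sum_of_subset (subset_univ _)
        _ ≤ 2 * (tr (joinInputs y z)).cost := sum_cost_view_le _
        _ ≤ 2 * b := Nat.mul_le_mul_left _ (hcost _)
    have hs' : (∑ i : Fin K, (((tr (joinInputs y z)).view (site (some i))).cost : ℝ)) ≤ 2 * b := by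
      exact_mod_cast hs
    have := mul_le_mul_of_nonneg_right hs' hL
    simpa using this

/-- The communication lower bound for any problem that encodes disjointness of one set with each of
`K` sets, under the promise of at most one crossing. -/
theorem le_cost_of_encodes_disjointness (hk : 0 < k) (site : Option (Fin K) → Fin k)
    (hsite : Injective site) (enc : (Option (Fin K) → Cube r) → Fin k → X)
    (henc : ∀ D D' s, (∀ o, site o = s → D o = D' o) → enc D s = enc D' s)
    (I : Set (Fin k → X)) (f : (Fin k → X) → Prop) (hI : ∀ D, enc D ∈ I)
    (hf : ∀ c y z, Promise c y z → (f (enc (joinInputs y z)) ↔ c = true))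
    {b : ℕ} (h : HasRandomizedProtocol I f (1 / 3) b) :
    (K * r : ℝ) / 4 ≤ 192 * (K * Real.log 8 + 2 * b * Real.log (8 * k ^ 2)) := by
  classical
  obtain ⟨Ω, _, μ, _, P, hcost, herr⟩ := h
  set A : Cube r × (Fin K → Cube r) → Set Ω := fun w =>
    {ω | ¬ (P ω).Outputs (enc (joinInputs w.1 w.2)) (f (enc (joinInputs w.1 w.2)))} with hA
  obtain ⟨ω, hω⟩ := exists_outcome μ (fun w => plantedWeight false w + plantedWeight true w)
    (fun w => add_nonneg (plantedWeight_nonneg _ _) (plantedWeight_nonneg _ _)) A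
    (fun w => herr _ (hI _))
  set E : Cube r → (Fin K → Cube r) → ℝ := fun y z => (A (y, z)).indicator 1 ω with hE
  -- Each planted distribution has total mass `K * r`, and the chosen outcome errs on at most a
  -- third of both together.
  have hω' : plantedProb K E false + plantedProb K E true ≤ 2 * (K * r) / 3 := by
    have h1 := plantedProb_one (r := r) (K := K) false
    have h2 := plantedProb_one (r := r) (K := K) true
    rw [plantedProb_eq_sum] at h1 h2
    rw [plantedProb_eq_sum, plantedProb_eq_sum, ← sum_add_distrib]
    simp only [mul_one] at h1 h2
    rw [sum_add_distrib, h1, h2] at hω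
    calc _ = ∑ w, (plantedWeight false w + plantedWeight true w) * (A w).indicator 1 ω :=
          sum_congr rfl fun w _ => by rw [add_mul]
      _ ≤ _ := hω
      _ = _ := by ring
  have hmain := plantedProb_outputs_sub_le hk site hsite enc henc (P ω) b
    (fun D => hcost _ (hI D) ω)
  set O : Cube r → (Fin K → Cube r) → ℝ := fun y z =>
    if (P ω).Outputs (enc (joinInputs y z)) False then 1 else 0 with hO
  have h0 : (K * r : ℝ) - plantedProb K E false ≤ plantedProb K O false := by
    rw [← plantedProb_one (r := r) (K := K) false, ← plantedProb_sub]
    refine plantedProb_mono fun y z hp => ?_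
    have hfalse : f (enc (joinInputs y z)) = False := by
      have := hf false y z hp
      simpa using this
    by_cases hm : (P ω).Outputs (enc (joinInputs y z)) False
    · have : 0 ≤ E y z := Set.indicator_nonneg (fun _ _ => zero_le_one) _
      simp only [hO, if_pos hm]
      linarith
    · have : E y z = 1 := by
        have : ω ∈ A (y, z) := by simpa [hA, hfalse] using hm
        simp [hE, this]
      simp [hO, hm, this]
  have h1 : plantedProb K O true ≤ plantedProb K E true := by
    refine plantedProb_mono fun y z hp => ?_
    have htrue : f (enc (joinInputs y z)) = True := by
      have := hf true y z hp
      simpa using this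
    by_cases hm : (P ω).Outputs (enc (joinInputs y z)) False
    · have : E y z = 1 := by
        have : ω ∈ A (y, z) := by
          simp only [hA, Set.mem_ofPred_eq, htrue]
          rintro ⟨t, i, ht, ha⟩
          obtain ⟨t', i', ht', ha'⟩ := hm
          obtain ⟨rfl, rfl⟩ := ht.unique ht'
          simp [ha] at ha'
        simp [hE, this]
      simp [hO, hm, this]
    · have : 0 ≤ E y z := Set.indicator_nonneg (fun _ _ => zero_le_one) _
      simpa [hO, hm] using this
  -- The answer `False` differs in mass by at least `K * r - 2 * K * r / 3 = K * r / 3`; subtracting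
  -- `K * r / 12` leaves `K * r / 4`.
  linarith

end Core

end MessagePassing

namespace MessagePassing

/-! ### Graph gadgets encoding disjointness, and padding to given numbers of vertices and edges. -/

section Gadget

open Function

variable {K r : ℕ}

/-- A family of graphs on `V` that encodes disjointness. The graph has one edge for each slot, the
slots are owned by the common party or by a player, and each edge depends on the input of its owner
only. -/
structure Gadget (K r : ℕ) (V I : Type) where
  owner : I → Option (Fin K)
  edge : I → Cube r → Sym2 V
  not_isDiag : ∀ e c, ¬ (edge e c).IsDiag
  injective : ∀ D : Option (Fin K) → Cube r, Injective fun e => edge e (D (owner e))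
  connected_iff : ∀ c y z, Promise c y z →
    ((SimpleGraph.fromEdgeSet (Set.range fun e => edge e (joinInputs y z (owner e)))).Connected ↔
      c = true)

namespace Gadget

variable {V I : Type}

/-- The graph of a gadget on the inputs `D`. -/
def graph (G : Gadget K r V I) (D : Option (Fin K) → Cube r) : SimpleGraph V :=
  SimpleGraph.fromEdgeSet (Set.range fun e => G.edge e (D (G.owner e)))

lemma graph_adj (G : Gadget K r V I) (D : Option (Fin K) → Cube r) (v w : V) :
    (G.graph D).Adj v w ↔ ∃ e, G.edge e (D (G.owner e)) = s(v, w) := by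
  simp only [graph, SimpleGraph.fromEdgeSet_adj, Set.mem_range]
  constructor
  · exact fun h => h.1
  · rintro ⟨e, he⟩
    refine ⟨⟨e, he⟩, fun hvw => G.not_isDiag e (D (G.owner e)) ?_⟩
    rw [he, hvw]
    rfl

/-- The inputs that a gadget gives to the sites. -/
def enc {k n : ℕ} (G : Gadget K r V I) (site : Option (Fin K) → Fin k) (g : V ≃ Fin n)
    (D : Option (Fin K) → Cube r) (s : Fin k) : SimpleGraph (Fin n) :=
  SimpleGraph.fromEdgeSet
    {a | ∃ e, site (G.owner e) = s ∧ (G.edge e (D (G.owner e))).map g = a}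

lemma enc_adj {k n : ℕ} (G : Gadget K r V I) (site : Option (Fin K) → Fin k) (g : V ≃ Fin n)
    (D : Option (Fin K) → Cube r) (s : Fin k) (a b : Fin n) :
    (G.enc site g D s).Adj a b ↔
      ∃ e, site (G.owner e) = s ∧ (G.edge e (D (G.owner e))).map g = s(a, b) := by
  simp only [enc, SimpleGraph.fromEdgeSet_adj]
  constructor
  · exact fun h => h.1
  · rintro ⟨e, he, he'⟩
    refine ⟨⟨e, he, he'⟩, ?_⟩
    rintro rfl
    have h2 : (Sym2.map g (G.edge e (D (G.owner e)))).IsDiag := by rw [he']; rfl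
    rw [Sym2.isDiag_map g.injective] at h2
    exact G.not_isDiag _ _ h2

lemma unionGraph_enc_adj {k n : ℕ} (G : Gadget K r V I) (site : Option (Fin K) → Fin k)
    (g : V ≃ Fin n) (D : Option (Fin K) → Cube r) (a b : Fin n) :
    (unionGraph (G.enc site g D)).Adj a b ↔
      ∃ e, (G.edge e (D (G.owner e))).map g = s(a, b) := by
  simp [unionGraph, enc_adj]

/-- A gadget graph is isomorphic to the union of the graphs given to the sites. -/
def isoUnionGraph {k n : ℕ} (G : Gadget K r V I) (site : Option (Fin K) → Fin k)
    (g : V ≃ Fin n) (D : Option (Fin K) → Cube r) : G.graph D ≃g unionGraph (G.enc site g D) where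
  toEquiv := g
  map_rel_iff' := by
    intro v w
    rw [unionGraph_enc_adj, graph_adj]
    refine exists_congr fun e => ?_
    rw [← Sym2.map_mk, (Sym2.map.injective g.injective).eq_iff]

/-- The communication lower bound for the connectivity problem from a gadget. -/
theorem le_cost [Finite I] {k n b : ℕ} {M : Set ℕ} (G : Gadget K r V I) (hK : K < k)
    (g : V ≃ Fin n) (hI : Nat.card I ∈ M)
    (h : HasRandomizedProtocol (edgePartitions k n M) (connectivity k n) (1 / 3) b) :
    (K * r : ℝ) / 4 ≤ 192 * (K * Real.log 8 + 2 * b * Real.log (8 * k ^ 2)) := by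
  set site : Option (Fin K) → Fin k := fun o =>
    o.elim ⟨0, by omega⟩ fun i => ⟨i + 1, by omega⟩ with hsite
  have hinj : Injective site := by
    rintro (_ | i) (_ | i') hs <;> simp [hsite, Fin.ext_iff] at hs ⊢
    exact hs
  refine le_cost_of_encodes_disjointness (by omega) site hinj (G.enc site g) ?_ _ _ ?_ ?_ h
  · intro D D' s hD
    unfold enc
    congr 1
    ext a
    refine exists_congr fun e => and_congr_right fun he => ?_
    rw [hD _ he]
  · intro D
    have hij := (Sym2.map.injective g.injective).comp (G.injective D)
    refine ⟨fun s t hst => ?_, ?_⟩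
    · dsimp only
      rw [disjoint_iff_inf_le]
      intro a b hab
      obtain ⟨h1, h2⟩ := hab
      rw [enc_adj] at h1 h2
      obtain ⟨e, he, he'⟩ := h1
      obtain ⟨f, hf, hf'⟩ := h2
      have : e = f := hij (he'.trans hf'.symm)
      subst this
      exact absurd (he.symm.trans hf) hst
    · have : (unionGraph (G.enc site g D)).edgeSet =
          Set.range (Sym2.map g ∘ fun e => G.edge e (D (G.owner e))) := by
        ext a
        induction a with
        | h a b => rw [SimpleGraph.mem_edgeSet, unionGraph_enc_adj]; rfl
      rw [this, ← Nat.card_coe_set_eq, Nat.card_range_of_injective hij]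
      exact hI
  · intro c y z hp
    rw [← G.connected_iff c y z hp]
    exact (G.isoUnionGraph site g (joinInputs y z)).connected_iff.symm

/-- Additional vertices, tied to the vertex `v₀` and with additional edges `S` among themselves, do
not affect the connectivity. -/
def pad (G : Gadget K r V I) (v₀ : V) {F : Type} (S : Finset (Sym2 F))
    (hS : ∀ a ∈ S, ¬ a.IsDiag) : Gadget K r (V ⊕ F) (I ⊕ F ⊕ S) where
  owner := Sum.elim G.owner fun _ => none
  edge := Sum.elim (fun e c => (G.edge e c).map Sum.inl)
    (Sum.elim (fun f _ => s(Sum.inl v₀, Sum.inr f)) fun a _ => a.1.map Sum.inr)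
  not_isDiag := by
    rintro (e | f | a) c
    · simpa [Sym2.isDiag_map Sum.inl_injective] using G.not_isDiag e c
    · simp
    · simpa [Sym2.isDiag_map Sum.inr_injective] using hS _ a.2
  injective := by
    intro D
    have h1 : ∀ (a : Sym2 V) (b : Sym2 F), a.map Sum.inl ≠ b.map (Sum.inr : F → V ⊕ F) := by
      intro a b
      induction a with | h a a' => induction b with | h b b' => simp
    have h2 : ∀ (a : Sym2 V) (v : V) (f : F), a.map Sum.inl ≠ s(Sum.inl v, Sum.inr f) := by
      intro a v f
      induction a with | h a a' => simp
    have h3 : ∀ (a : Sym2 F) (v : V) (f : F), a.map Sum.inr ≠ s(Sum.inl v, Sum.inr f) := by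
      intro a v f
      induction a with | h a a' => simp
    rintro (e | f | a) (e' | f' | a') h
    · exact congrArg Sum.inl (G.injective D (Sym2.map.injective Sum.inl_injective h))
    · exact absurd h (h2 _ _ _)
    · exact absurd h (h1 _ _)
    · exact absurd h.symm (h2 _ _ _)
    · simpa using h
    · exact absurd h.symm (h3 _ _ _)
    · exact absurd h.symm (h1 _ _)
    · exact absurd h (h3 _ _ _)
    · have := Sym2.map.injective Sum.inr_injective h
      simpa using this
  connected_iff := by
    intro c y z hp
    rw [← G.connected_iff c y z hp]
    change _ ↔ (G.graph (joinInputs y z)).Connected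
    set H := SimpleGraph.fromEdgeSet (Set.range fun e : I ⊕ F ⊕ S =>
      (Sum.elim (fun e c => (G.edge e c).map Sum.inl)
        (Sum.elim (fun f _ => s(Sum.inl v₀, Sum.inr f)) fun a _ => a.1.map Sum.inr) :
          I ⊕ F ⊕ S → Cube r → Sym2 (V ⊕ F)) e
        (joinInputs y z ((Sum.elim G.owner fun _ => none : I ⊕ F ⊕ S → _) e))) with hH
    have hll : ∀ v w, (G.graph (joinInputs y z)).Adj v w → H.Adj (Sum.inl v) (Sum.inl w) := by
      intro v w hvw
      have hne := hvw.ne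
      rw [graph_adj] at hvw
      obtain ⟨e, he⟩ := hvw
      rw [hH, SimpleGraph.fromEdgeSet_adj]
      exact ⟨⟨Sum.inl e, by simp [he]⟩, by simpa using hne⟩
    have hlr : ∀ f, H.Adj (Sum.inl v₀) (Sum.inr f) := by
      intro f
      rw [hH, SimpleGraph.fromEdgeSet_adj]
      exact ⟨⟨Sum.inr (Sum.inl f), rfl⟩, by simp⟩
    -- Collapsing the new vertices onto `v₀` maps walks of the padded graph to walks of the original
    -- one.
    set π : V ⊕ F → V := Sum.elim id fun _ => v₀ with hπ
    have hproj : ∀ a b, H.Adj a b → π a = π b ∨ (G.graph (joinInputs y z)).Adj (π a) (π b) := by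
      intro a b hab
      rw [hH, SimpleGraph.fromEdgeSet_adj] at hab
      obtain ⟨⟨e, he⟩, -⟩ := hab
      have he2 := congrArg (Sym2.map π) he
      rcases e with e | f | ⟨a', ha'⟩
      · right
        rw [graph_adj]
        refine ⟨e, ?_⟩
        simpa [Sym2.map_map, hπ, Function.comp_def] using he2
      · left
        simp [hπ] at he2
        rw [hπ]
        rcases he2 with h | h <;> rw [← h.1, ← h.2]
      · left
        induction a' with
        | h p q =>
          simp [hπ] at he2
          rw [hπ]
          rcases he2 with h | h <;> rw [← h.1, ← h.2]
    constructor
    · intro hc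
      have hreach : ∀ a b, H.Reachable a b → (G.graph (joinInputs y z)).Reachable (π a) (π b) := by
        rintro a b ⟨p⟩
        induction p with
        | nil => exact SimpleGraph.Reachable.refl _
        | cons hadj _ ih =>
          rcases hproj _ _ hadj with h | h
          · rw [h]; exact ih
          · exact h.reachable.trans ih
      have : Nonempty V := ⟨v₀⟩
      exact ⟨fun v w => hreach _ _ (hc.preconnected (Sum.inl v) (Sum.inl w))⟩
    · intro hc
      have hreach : ∀ v w, H.Reachable (Sum.inl v) (Sum.inl w) := by
        intro v w
        obtain ⟨p⟩ := hc.preconnected v w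
        induction p with
        | nil => exact SimpleGraph.Reachable.refl _
        | cons hadj _ ih => exact (hll _ _ hadj).reachable.trans ih
      have hbase : ∀ a, H.Reachable (Sum.inl v₀) a := by
        rintro (v | f)
        · exact hreach _ _
        · exact (hlr f).reachable
      have : Nonempty (V ⊕ F) := ⟨Sum.inl v₀⟩
      exact ⟨fun a b => (hbase a).symm.trans (hbase b)⟩

/-- The lower bound from a gadget for graphs with exactly `m` edges on `n` vertices. -/
theorem le_cost_of_pad [Fintype V] [Fintype I] {k n m b : ℕ} (G : Gadget K r V I) (v₀ : V)
    (hK : K < k) (hn : Fintype.card V ≤ n)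
    (hm : Fintype.card I + (n - Fintype.card V) ≤ m)
    (hm' : m ≤ Fintype.card I + (n - Fintype.card V) + (n - Fintype.card V).choose 2)
    (h : HasRandomizedProtocol (edgePartitions k n {m}) (connectivity k n) (1 / 3) b) :
    (K * r : ℝ) / 4 ≤ 192 * (K * Real.log 8 + 2 * b * Real.log (8 * k ^ 2)) := by
  classical
  set F := n - Fintype.card V with hF
  obtain ⟨S, hS, hcard⟩ := Finset.exists_subset_card_eq
    (s := (⊤ : SimpleGraph (Fin F)).edgeFinset) (n := m - (Fintype.card I + F)) (by
      rw [SimpleGraph.card_edgeFinset_top_eq_card_choose_two, Fintype.card_fin]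
      omega)
  have hS' : ∀ a ∈ S, ¬ a.IsDiag := fun a ha =>
    SimpleGraph.not_isDiag_of_mem_edgeFinset (hS ha)
  refine (G.pad v₀ S hS').le_cost hK (Fintype.equivFinOfCardEq ?_) ?_ h
  · rw [Fintype.card_sum, Fintype.card_fin]
    omega
  · rw [Nat.card_eq_fintype_card, Set.mem_singleton_iff, Fintype.card_sum, Fintype.card_sum,
      Fintype.card_fin, Fintype.card_coe, hcard]
    omega

end Gadget

end Gadget

end MessagePassing

namespace MessagePassing

/-! ### Criteria for connectivity. -/

section Connectivity

lemma not_connected_of_invariant {V : Type*} {H : SimpleGraph V} (p : V → Prop)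
    (hp : ∀ v w, H.Adj v w → (p v ↔ p w)) {v w : V} (hv : p v) (hw : ¬ p w) : ¬ H.Connected := by
  intro hc
  have : ∀ a b, H.Reachable a b → (p a ↔ p b) := by
    rintro a b ⟨q⟩
    induction q with
    | nil => rfl
    | cons h _ ih => exact (hp _ _ h).trans ih
  exact hw ((this v w (hc.preconnected v w)).1 hv)

lemma connected_of_reachable {V : Type*} {H : SimpleGraph V} (v : V)
    (h : ∀ w, H.Reachable v w) : H.Connected :=
  haveI : Nonempty V := ⟨v⟩
  ⟨fun a b => (h a).symm.trans (h b)⟩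

end Connectivity

/-! ### The dense gadget, with about `K * r` edges on about `K + 2 * r` vertices. -/

section Dense

variable (K r : ℕ)

/-- The vertices of the dense gadget: two hubs, an apex for each player, and for each coordinate a
live vertex (`true`) and a dummy vertex (`false`). -/
abbrev DenseVertex := Bool ⊕ Fin K ⊕ Bool × Fin r

/-- The edge slots of the dense gadget. -/
abbrev DenseSlot := (Bool × Fin r) ⊕ Fin K ⊕ Fin K × Fin r

variable {K r}

/-- The owner of a slot of the dense gadget. -/
def denseOwner : DenseSlot K r → Option (Fin K)
  | .inl _ => none
  | .inr (.inl _) => none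
  | .inr (.inr p) => some p.1

/-- The edges of the dense gadget: the live vertex of `j` is tied to the hub `true` if the common
party has `j` and to the hub `false` otherwise, all dummy vertices and apices are tied to the hub
`false`, and the apex of player `i` is tied to the live or to the dummy vertex of `j`. -/
def denseEdge : DenseSlot K r → Cube r → Sym2 (DenseVertex K r)
  | .inl p, c => s(.inr (.inr p), .inl (p.1 && c p.2))
  | .inr (.inl i), _ => s(.inr (.inl i), .inl false)
  | .inr (.inr p), c => s(.inr (.inl p.1), .inr (.inr (c p.2, p.2)))

lemma dense_connected_iff (y : Cube r) (z : Fin K → Cube r) :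
    (SimpleGraph.fromEdgeSet (Set.range fun e : DenseSlot K r =>
      denseEdge e (joinInputs y z (denseOwner e)))).Connected ↔ ∃ p, Crossing y z p := by
  set H := SimpleGraph.fromEdgeSet (Set.range fun e : DenseSlot K r =>
      denseEdge e (joinInputs y z (denseOwner e))) with hH
  have hadj : ∀ (e : DenseSlot K r) v w, denseEdge e (joinInputs y z (denseOwner e)) = s(v, w) →
      v ≠ w → H.Adj v w := by
    intro e v w he hne
    rw [hH, SimpleGraph.fromEdgeSet_adj]
    exact ⟨⟨e, he⟩, hne⟩
  constructor
  · intro hc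
    by_contra hno
    -- Without a crossing, the hub `true` is connected only to the live vertices of the common set.
    refine not_connected_of_invariant (H := H)
      (fun v : DenseVertex K r => v.elim (fun c => c = true)
        (Sum.elim (fun _ => False) fun p => p.1 = true ∧ y p.2 = true))
      ?_ (v := .inl true) (w := .inl false) (by simp) (by simp) hc
    intro v w hvw
    rw [hH, SimpleGraph.fromEdgeSet_adj] at hvw
    obtain ⟨⟨e, he⟩, -⟩ := hvw
    rcases e with p | i | p
    · simp only [denseEdge, denseOwner, joinInputs, Sym2.eq_iff] at he
      rcases he with ⟨rfl, rfl⟩ | ⟨rfl, rfl⟩ <;> simp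
    · simp only [denseEdge, Sym2.eq_iff] at he
      rcases he with ⟨rfl, rfl⟩ | ⟨rfl, rfl⟩ <;> simp
    · have hp : ¬ (z p.1 p.2 = true ∧ y p.2 = true) := fun h => hno ⟨p, h⟩
      simp only [denseEdge, denseOwner, joinInputs, Sym2.eq_iff] at he
      rcases he with ⟨rfl, rfl⟩ | ⟨rfl, rfl⟩ <;> simpa using hp
  · rintro ⟨⟨i, j⟩, hz, hy⟩
    have hapex : ∀ i : Fin K, H.Reachable (.inl false) (.inr (.inl i)) := fun i =>
      (hadj (.inr (.inl i)) _ _ rfl (by simp)).symm.reachable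
    have h1 : H.Adj (.inr (.inl i)) (.inr (.inr (true, j))) :=
      hadj (.inr (.inr (i, j))) _ _ (by
        simp only [denseEdge, denseOwner, joinInputs, Option.elim, hz]) (by simp)
    have h2 : H.Adj (.inr (.inr (true, j))) (.inl true) :=
      hadj (.inl (true, j)) _ _ (by
        simp [denseEdge, denseOwner, joinInputs, hy]) (by simp)
    have hhub : ∀ c : Bool, H.Reachable (.inl false) (.inl c) := by
      intro c
      cases c
      · exact SimpleGraph.Reachable.refl _
      · exact (hapex i).trans (h1.reachable.trans h2.reachable)
    refine connected_of_reachable (.inl false) ?_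
    rintro (c | i | p)
    · exact hhub c
    · exact hapex i
    · exact (hhub _).trans (hadj (.inl p) _ _ rfl (by simp)).symm.reachable

/-- The dense gadget. -/
def denseGadget (K r : ℕ) : Gadget K r (DenseVertex K r) (DenseSlot K r) where
  owner := denseOwner
  edge := denseEdge
  not_isDiag := by rintro (p | i | p) c <;> simp [denseEdge]
  injective := by
    intro D
    rintro (⟨c, j⟩ | i | ⟨i, j⟩) (⟨c', j'⟩ | i' | ⟨i', j'⟩) h <;> simp [denseEdge] at h ⊢
    · exact h.1
    · exact h
    · exact ⟨h.1, h.2.2⟩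
  connected_iff := by
    intro c y z hp
    rw [dense_connected_iff]
    cases c
    · simpa [Promise] using hp
    · simpa [Promise] using hp.exists

end Dense

/-! ### The sparse gadget, with one edge fewer than vertices. -/

section Sparse

open Equiv

/-- The strand on which a path through the layers `π` arrives after `t` steps. -/
def strandPerm (π : ℕ → Perm (Fin 3)) : ℕ → Perm (Fin 3)
  | 0 => 1
  | t + 1 => π t * strandPerm π t

/-- The edge slots of three strands with `T` layers, tied at both ends. -/
abbrev StrandSlot (T : ℕ) := Fin T × Fin 3 ⊕ Bool

/-- The edge of three strands with `T` layers for a slot, given the permutation of its layer. -/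
def strandEdge {T : ℕ} : StrandSlot T → Perm (Fin 3) → Sym2 (Fin (T + 1) × Fin 3)
  | .inl p, σ => s((p.1.castSucc, p.2), (p.1.succ, σ p.2))
  | .inr false, _ => s((0, 0), (0, 1))
  | .inr true, _ => s((Fin.last T, 0), (Fin.last T, 1))

/-- The layer of a slot. -/
def StrandSlot.layer {T : ℕ} : StrandSlot T → ℕ
  | .inl p => p.1
  | .inr _ => 0

lemma strandEdge_not_isDiag {T : ℕ} (e : StrandSlot T) (σ : Perm (Fin 3)) :
    ¬ (strandEdge e σ).IsDiag := by
  rcases e with p | _ | _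
  · simp [strandEdge, Fin.ext_iff]
  · simp [strandEdge]
  · simp [strandEdge]

/-- For `T = 0` the two ties would coincide. -/
lemma strandEdge_injective {T : ℕ} (hT : 0 < T) (π : StrandSlot T → Perm (Fin 3)) :
    Function.Injective fun e : StrandSlot T => strandEdge e (π e) := by
  intro e e' h
  have hlayer : (strandEdge e (π e)).map (fun p => (p.1 : ℕ))
      = (strandEdge e' (π e')).map (fun p => (p.1 : ℕ)) := congrArg _ h
  rcases e with ⟨t, s⟩ | _ | _ <;> rcases e' with ⟨t', s'⟩ | _ | _
  · simp only [strandEdge, Sym2.eq_iff, Prod.mk.injEq] at h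
    rcases h with ⟨⟨h1, h2⟩, -⟩ | ⟨⟨h1, -⟩, ⟨h2, -⟩⟩
    · rw [Fin.castSucc_inj.1 h1, h2]
    · simp only [Fin.ext_iff, Fin.val_castSucc, Fin.val_succ] at h1 h2
      omega
  all_goals first
    | rfl
    | (simp [strandEdge] at hlayer; done)
    | (simp [strandEdge] at hlayer; omega)

/-- Three strands with layers `π`, tied at both ends. -/
def strandGraph (T : ℕ) (π : ℕ → Perm (Fin 3)) : SimpleGraph (Fin (T + 1) × Fin 3) :=
  SimpleGraph.fromEdgeSet (Set.range fun e : StrandSlot T => strandEdge e (π e.layer))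

/-- The strand starting at 2 also ends at 2, while both ties join the strands 0 and 1. -/
lemma strandGraph_not_connected {T : ℕ} {π : ℕ → Perm (Fin 3)} (h : strandPerm π T = 1) :
    ¬ (strandGraph T π).Connected := by
  refine not_connected_of_invariant
    (fun v : Fin (T + 1) × Fin 3 => v.2 = strandPerm π v.1 2) ?_ (v := (0, 2)) (w := (0, 0))
    (by simp [strandPerm]) (by simp [strandPerm])
  intro v w hvw
  rw [strandGraph, SimpleGraph.fromEdgeSet_adj] at hvw
  obtain ⟨⟨e, he⟩, -⟩ := hvw
  rcases e with ⟨t, s⟩ | _ | _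
  · simp only [strandEdge, StrandSlot.layer, Sym2.eq_iff] at he
    rcases he with ⟨rfl, rfl⟩ | ⟨rfl, rfl⟩ <;> simp [strandPerm]
  · simp only [strandEdge, Sym2.eq_iff] at he
    rcases he with ⟨rfl, rfl⟩ | ⟨rfl, rfl⟩ <;> simp [strandPerm]
  · simp only [strandEdge, Sym2.eq_iff] at he
    rcases he with ⟨rfl, rfl⟩ | ⟨rfl, rfl⟩ <;> simp [h]

/-- The tie at the start joins strands 0 and 1. They end at 1 and elsewhere, strand 2 ends at 0, so
the tie at the end joins strands 0 and 2. -/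
lemma strandGraph_connected {T : ℕ} {π : ℕ → Perm (Fin 3)}
    (h0 : strandPerm π T 0 = 1) (h2 : strandPerm π T 2 = 0) : (strandGraph T π).Connected := by
  have hadj : ∀ (e : StrandSlot T) v w, strandEdge e (π e.layer) = s(v, w) →
      (strandGraph T π).Reachable v w := by
    intro e v w he
    refine SimpleGraph.Adj.reachable ?_
    rw [strandGraph, SimpleGraph.fromEdgeSet_adj]
    refine ⟨⟨e, he⟩, fun hvw => strandEdge_not_isDiag e (π e.layer) ?_⟩
    rw [he, hvw]; rfl
  have hstrand : ∀ (t : ℕ) (ht : t < T + 1) (s : Fin 3),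
      (strandGraph T π).Reachable (0, s) (⟨t, ht⟩, strandPerm π t s) := by
    intro t
    induction t with
    | zero => intro _ s; exact SimpleGraph.Reachable.refl _
    | succ t ih =>
      intro ht s
      refine (ih (by omega) s).trans ?_
      exact hadj (.inl (⟨t, by omega⟩, strandPerm π t s)) _ _ rfl
  have h01 : (strandGraph T π).Reachable (0, 0) (0, 1) := hadj (.inr false) _ _ rfl
  have hend : (strandGraph T π).Reachable (Fin.last T, 0) (Fin.last T, 1) :=
    hadj (.inr true) _ _ rfl
  have hs0 := hstrand T (by omega) 0
  have hs2 := hstrand T (by omega) 2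
  rw [h0] at hs0
  rw [h2] at hs2
  have h02 : (strandGraph T π).Reachable (0, 0) (0, 2) :=
    hs0.trans (hend.symm.trans hs2.symm)
  have hstart : ∀ s : Fin 3, (strandGraph T π).Reachable (0, 0) (0, s) := by
    intro s
    fin_cases s
    · exact SimpleGraph.Reachable.refl _
    · exact h01
    · exact h02
  refine connected_of_reachable (0, 0) ?_
  rintro ⟨⟨t, ht⟩, s⟩
  have := (hstart ((strandPerm π t)⁻¹ s)).trans (hstrand t ht _)
  simpa using this

/-- The permutation of layer `t` controlled by a bit. -/
def layerPerm (t : ℕ) (c : Bool) : Perm (Fin 3) :=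
  if c then (if t % 2 = 0 then swap 0 1 else swap 1 2) else 1

/-- The commutator of the two transpositions. -/
def commutatorPerm : Perm (Fin 3) := swap 1 2 * swap 0 1 * swap 1 2 * swap 0 1

/-- Barrington's trick: the commutator of two controlled transpositions computes a conjunction. With
one bit off, the remaining transposition occurs twice and cancels. -/
lemma layerPerm_block (q : ℕ) (x y : Bool) :
    layerPerm (4 * q + 3) y * layerPerm (4 * q + 2) x * layerPerm (4 * q + 1) y *
      layerPerm (4 * q) x = if x = true ∧ y = true then commutatorPerm else 1 := by
  have h0 : (4 * q) % 2 = 0 := by omega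
  have h1 : (4 * q + 1) % 2 = 1 := by omega
  have h2 : (4 * q + 2) % 2 = 0 := by omega
  have h3 : (4 * q + 3) % 2 = 1 := by omega
  unfold layerPerm commutatorPerm
  rw [h0, h1, h2, h3]
  cases x <;> cases y <;> simp

lemma strandPerm_block (x y : ℕ → Bool) (q : ℕ) :
    strandPerm (fun t => layerPerm t (if t % 2 = 0 then x (t / 4) else y (t / 4))) (4 * (q + 1))
      = (if x q = true ∧ y q = true then commutatorPerm else 1) *
        strandPerm (fun t => layerPerm t (if t % 2 = 0 then x (t / 4) else y (t / 4))) (4 * q) := by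
  have e0 : (4 * q) % 2 = 0 := by omega
  have e1 : (4 * q + 1) % 2 = 1 := by omega
  have e2 : (4 * q + 2) % 2 = 0 := by omega
  have e3 : (4 * q + 3) % 2 = 1 := by omega
  have d0 : (4 * q) / 4 = q := by omega
  have d1 : (4 * q + 1) / 4 = q := by omega
  have d2 : (4 * q + 2) / 4 = q := by omega
  have d3 : (4 * q + 3) / 4 = q := by omega
  rw [← layerPerm_block q, show 4 * (q + 1) = 4 * q + 3 + 1 by ring]
  simp only [strandPerm, e0, e1, e2, e3, d0, d1, d2, d3, if_true, one_ne_zero, if_false, mul_assoc]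

lemma strandPerm_eq_one (x y : ℕ → Bool) (N : ℕ) (h : ∀ q < N, ¬ (x q = true ∧ y q = true)) :
    strandPerm (fun t => layerPerm t (if t % 2 = 0 then x (t / 4) else y (t / 4))) (4 * N) = 1 := by
  induction N with
  | zero => rfl
  | succ N ih =>
    rw [strandPerm_block, ih fun q hq => h q (by omega), if_neg (h N (by omega)), one_mul]

/-- Uniqueness of the crossing matters: the commutator is a 3-cycle, so three crossings would
cancel. -/
lemma strandPerm_eq_commutatorPerm (x y : ℕ → Bool) (N q₀ : ℕ) (hq₀ : q₀ < N)
    (h : ∀ q < N, (x q = true ∧ y q = true) ↔ q = q₀) :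
    strandPerm (fun t => layerPerm t (if t % 2 = 0 then x (t / 4) else y (t / 4))) (4 * N)
      = commutatorPerm := by
  induction N with
  | zero => omega
  | succ N ih =>
    rw [strandPerm_block]
    by_cases hN : q₀ = N
    · subst hN
      rw [if_pos ((h q₀ (by omega)).2 rfl), strandPerm_eq_one, mul_one]
      intro q hq hc
      exact hq.ne ((h q (by omega)).1 hc)
    · rw [ih (by omega) fun q hq => h q (by omega), if_neg, one_mul]
      rw [h N (by omega)]
      exact fun h' => hN h'.symm

variable {K r : ℕ}

/-- The player and the coordinate that belong to block `q`. -/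
def blockIndex (hpos : 0 < K * r) (q : ℕ) : Fin K × Fin r :=
  finProdFinEquiv.symm ⟨q % (K * r), Nat.mod_lt _ hpos⟩

/-- The owner of a layer: the players and the common party alternate. -/
def layerOwner (hpos : 0 < K * r) (t : ℕ) : Option (Fin K) :=
  if t % 2 = 0 then some (blockIndex hpos (t / 4)).1 else none

lemma layer_input (hpos : 0 < K * r) (y : Cube r) (z : Fin K → Cube r) (t : ℕ) :
    joinInputs y z (layerOwner hpos t) (blockIndex hpos (t / 4)).2
      = if t % 2 = 0 then z (blockIndex hpos (t / 4)).1 (blockIndex hpos (t / 4)).2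
        else y (blockIndex hpos (t / 4)).2 := by
  unfold layerOwner
  split_ifs <;> rfl

/-- The sparse gadget: three strands in which the players and the common party control alternate
layers. -/
def sparseGadget (hpos : 0 < K * r) :
    Gadget K r (Fin (4 * (K * r) + 1) × Fin 3) (StrandSlot (4 * (K * r))) where
  owner e := layerOwner hpos e.layer
  edge e c := strandEdge e (layerPerm e.layer (c (blockIndex hpos (e.layer / 4)).2))
  not_isDiag _ _ := strandEdge_not_isDiag _ _
  injective D := strandEdge_injective (by omega) _
  connected_iff := by
    intro c y z hp
    set xs : ℕ → Bool := fun q => z (blockIndex hpos q).1 (blockIndex hpos q).2 with hxs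
    set ys : ℕ → Bool := fun q => y (blockIndex hpos q).2 with hys
    simp only [layer_input]
    change (strandGraph (4 * (K * r)) fun t =>
      layerPerm t (if t % 2 = 0 then xs (t / 4) else ys (t / 4))).Connected ↔ c = true
    cases c
    · simp only [Bool.false_eq_true, iff_false]
      refine strandGraph_not_connected (strandPerm_eq_one xs ys (K * r) fun q _ => ?_)
      exact hp (blockIndex hpos q)
    · simp only [iff_true]
      obtain ⟨p, hp, huniq⟩ := hp
      have hidx : ∀ q < K * r, blockIndex hpos q = p ↔ q = finProdFinEquiv p := by
        intro q hq
        unfold blockIndex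
        rw [Equiv.symm_apply_eq, Fin.ext_iff]
        simp only [Nat.mod_eq_of_lt hq]
      have hperm := strandPerm_eq_commutatorPerm xs ys (K * r) (finProdFinEquiv p)
        (finProdFinEquiv p).2 fun q hq => by
          rw [← hidx q hq]
          constructor
          · exact fun h => huniq _ h
          · rintro rfl; exact hp
      exact strandGraph_connected (by rw [hperm]; decide) (by rw [hperm]; decide)

end Sparse

end MessagePassing

namespace MessagePassing

/-! ### Monotonicity and postprocessing of protocols. -/

section Reductions

variable {k : ℕ} {X β γ : Type}

lemma HasRandomizedProtocol.mono {D D' : Set (Fin k → X)} {f : (Fin k → X) → β} {δ : ℝ≥0∞} {b : ℕ}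
    (hD : D' ⊆ D) (h : HasRandomizedProtocol D f δ b) : HasRandomizedProtocol D' f δ b := by
  obtain ⟨Ω, hΩ, μ, hμ, P, h1, h2⟩ := h
  exact ⟨Ω, hΩ, μ, hμ, P, fun x hx => h1 x (hD hx), fun x hx => h2 x (hD hx)⟩

/-- Apply a function to the answer of a protocol. -/
def Protocol.map (P : Protocol k X β) (g : β → γ) : Protocol k X γ where
  turn := P.turn
  send := P.send
  answer i x t := g (P.answer i x t)

lemma HasRandomizedProtocol.map {D : Set (Fin k → X)} {f : (Fin k → X) → β} {δ : ℝ≥0∞} {b : ℕ}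
    (g : β → γ) (h : HasRandomizedProtocol D f δ b) :
    HasRandomizedProtocol D (fun x => g (f x)) δ b := by
  obtain ⟨Ω, hΩ, μ, hμ, P, h1, h2⟩ := h
  refine ⟨Ω, hΩ, μ, hμ, fun ω => (P ω).map g, fun x hx ω => h1 x hx ω, fun x hx => ?_⟩
  refine (MeasureTheory.measure_mono fun ω hω => ?_).trans (h2 x hx)
  rintro ⟨t, i, ht, ha⟩
  exact hω ⟨t, i, ht, congrArg g ha⟩

lemma ofReal_le_randCC {D : Set (Fin k → X)} {f : (Fin k → X) → β} {δ : ℝ≥0∞} {z : ℝ}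
    (h : ∀ b, HasRandomizedProtocol D f δ b → z ≤ b) :
    ENNReal.ofReal z ≤ (randCC D f δ : ℝ≥0∞) := by
  have h1 : ((⌈z⌉₊ : ℕ) : ℕ∞) ≤ randCC D f δ :=
    le_iInf₂ fun b hb => by exact_mod_cast Nat.ceil_le.2 (h b hb)
  calc ENNReal.ofReal z ≤ ENNReal.ofReal (⌈z⌉₊ : ℝ) := ENNReal.ofReal_le_ofReal (Nat.le_ceil z)
    _ = (((⌈z⌉₊ : ℕ) : ℕ∞) : ℝ≥0∞) := by simp
    _ ≤ _ := by exact_mod_cast h1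

lemma connected_iff_card_connectedComponent {V : Type*} (H : SimpleGraph V) :
    H.Connected ↔ Nat.card H.ConnectedComponent = 1 := by
  rw [Nat.card_eq_one_iff_unique]
  constructor
  · intro h
    obtain ⟨v⟩ := h.nonempty
    exact ⟨h.preconnected.subsingleton_connectedComponent, ⟨H.connectedComponentMk v⟩⟩
  · rintro ⟨h1, ⟨c⟩⟩
    induction c using SimpleGraph.ConnectedComponent.ind with
    | h v =>
      have : Nonempty V := ⟨v⟩
      exact ⟨fun a b => SimpleGraph.ConnectedComponent.exact (Subsingleton.elim _ _)⟩

lemma HasRandomizedProtocol.connectivity {k n b : ℕ} {D : Set (Fin k → SimpleGraph (Fin n))}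
    {δ : ℝ≥0∞} (h : HasRandomizedProtocol D (numComponents k n) δ b) :
    HasRandomizedProtocol D (connectivity k n) δ b := by
  convert! h.map (fun a => a = 1) using 1
  ext x
  exact connected_iff_card_connectedComponent _

end Reductions

/-! ### Choice of parameters and constants. -/

section Parameters

/-- For `k = 1` the divisor is `log 1 = 0`, and division by zero gives 0. -/
lemma boundExpr_of_le_one {n m k : ℕ} (hk : k ≤ 1) : boundExpr n m k = 0 := by
  unfold boundExpr
  interval_cases k <;> simp

lemma log_eight_mul_sq_le {k : ℕ} (hk : 2 ≤ k) :
    Real.log (8 * (k : ℝ) ^ 2) ≤ 5 * Real.logb 2 k := by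
  have hk' : (2 : ℝ) ≤ k := by exact_mod_cast hk
  have h1 : 1 ≤ Real.logb 2 k := by
    rw [Real.le_logb_iff_rpow_le (by norm_num) (by linarith)]
    simpa using hk'
  have h2 : Real.log k = Real.logb 2 k * Real.log 2 := by
    rw [Real.logb, div_mul_cancel₀ _ (Real.log_pos (by norm_num)).ne']
  have h3 : Real.log 8 = 3 * Real.log 2 := by
    rw [show (8 : ℝ) = 2 ^ 3 by norm_num, Real.log_pow]; norm_num
  rw [Real.log_mul (by norm_num) (by positivity), Real.log_pow, h2, h3]
  have h4 : Real.log 2 ≤ 1 := by linarith [Real.log_two_lt_d9]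
  have h5 : 0 ≤ Real.log 2 := Real.log_nonneg (by norm_num)
  push_cast
  nlinarith

/-- The additive term is at most `576 * K`, which `r ≥ 4608 = 8 * 576` absorbs into `K * r / 8`. The
rest is `15360 = 8 * 192 * 2 * 5`. -/
lemma mul_le_of_encoding_bound {K r k b : ℕ} (hr : 4608 ≤ r) (hk : 2 ≤ k)
    (h : (K * r : ℝ) / 4 ≤ 192 * (K * Real.log 8 + 2 * b * Real.log (8 * k ^ 2))) :
    (K * r : ℝ) ≤ 15360 * (b * Real.logb 2 k) := by
  have h1 : Real.log 8 ≤ 3 := by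
    rw [show (8 : ℝ) = 2 ^ 3 by norm_num, Real.log_pow]
    push_cast
    linarith [Real.log_two_lt_d9]
  have h2 := log_eight_mul_sq_le hk
  have h3 : (K : ℝ) * Real.log 8 ≤ K * 3 := by gcongr
  have h4 : (b : ℝ) * Real.log (8 * k ^ 2) ≤ b * (5 * Real.logb 2 k) := by gcongr
  have h5 : (K : ℝ) * 4608 ≤ K * r := by
    have : (4608 : ℝ) ≤ r := by exact_mod_cast hr
    gcongr
  nlinarith

/-- Enough room for the additional edges. -/
lemma le_choose_of_le {n m p : ℕ} {ε : ℝ} (hε0 : 0 < ε) (hε : ε ≤ 1) (hp : (p : ℝ) ≤ ε / 2 * n)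
    (hm : (m : ℝ) ≤ (1 - ε) * (n.choose 2 : ℝ)) : p ≤ n ∧ m ≤ (n - p) + (n - p).choose 2 := by
  have hn0 : (0 : ℝ) ≤ n := Nat.cast_nonneg n
  have hpn : (p : ℝ) ≤ n := by nlinarith
  have hpn' : p ≤ n := by exact_mod_cast hpn
  refine ⟨hpn', ?_⟩
  have h1 : (m : ℝ) ≤ (n - p : ℕ) + ((n - p).choose 2 : ℝ) := by
    rw [Nat.cast_choose_two, Nat.cast_sub hpn']
    rw [Nat.cast_choose_two] at hm
    have h2 : (1 - ε / 2) * (n : ℝ) ≤ n - p := by linarith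
    have h3 : 0 ≤ (1 - ε / 2) * (n : ℝ) := by nlinarith
    -- Uses `(1 - ε / 2) ^ 2 ≥ 1 - ε`: sparing a fraction `ε / 2` of the vertices still leaves room
    -- for `m` edges.
    have h4 : ((1 - ε / 2) * (n : ℝ)) ^ 2 ≤ ((n : ℝ) - p) ^ 2 := by gcongr
    nlinarith [mul_nonneg hn0 hn0, mul_nonneg hε0.le hε0.le, mul_nonneg (sub_nonneg.2 hε) hn0,
      mul_nonneg (mul_nonneg hε0.le hε0.le) (mul_nonneg hn0 hn0)]
  exact_mod_cast h1

/-- The bound from the gadgets for suitable numbers `K` of players and `r` of coordinates. -/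
lemma mul_le_cost {n m k K r b : ℕ} {ε : ℝ} (hε0 : 0 < ε) (hε : ε ≤ 1)
    (hnm : n ≤ m) (hm : (m : ℝ) ≤ (1 - ε) * (n.choose 2 : ℝ)) (hk : 2 ≤ k) (hK : K < k)
    (hK0 : 0 < K) (hr : 4608 ≤ r) (hKr : 2 * (K * r) ≤ m)
    (hdense : ((2 + K + 2 * r : ℕ) : ℝ) ≤ ε / 2 * n)
    (hsparse : m < 2 * n → ((12 * (K * r) + 3 : ℕ) : ℝ) ≤ ε / 2 * n)
    (h : HasRandomizedProtocol (edgePartitions k n {m}) (connectivity k n) (1 / 3) b) :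
    (K * r : ℝ) ≤ 15360 * (b * Real.logb 2 k) := by
  refine mul_le_of_encoding_bound hr hk ?_
  have hpos : 0 < K * r := Nat.mul_pos hK0 (by omega)
  -- The padded sparse gadget needs only `n - 1` edges, but its vertex count is of order `K * r`,
  -- which must be small against `n`. The padded dense gadget has few core vertices but needs `K * r
  -- + n - 2` edges.
  rcases lt_or_ge m (2 * n) with hlt | hge
  · obtain ⟨h1, h2⟩ := le_choose_of_le hε0 hε (hsparse hlt) hm
    have hV : Fintype.card (Fin (4 * (K * r) + 1) × Fin 3) = 12 * (K * r) + 3 := by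
      simp; ring
    have hI : Fintype.card (StrandSlot (4 * (K * r))) = 12 * (K * r) + 2 := by
      simp; ring
    refine (sparseGadget hpos).le_cost_of_pad (0, 0) hK ?_ ?_ ?_ h <;> rw [hV] <;>
      (try rw [hI]) <;> omega
  · obtain ⟨h1, h2⟩ := le_choose_of_le hε0 hε hdense hm
    have hV : Fintype.card (DenseVertex K r) = 2 + K + 2 * r := by
      simp; ring
    have hI : Fintype.card (DenseSlot K r) = 2 * r + K + K * r := by
      simp; ring
    refine (denseGadget K r).le_cost_of_pad (.inl false) hK ?_ ?_ ?_ h <;> rw [hV] <;>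
      (try rw [hI]) <;> omega

/-- The connectivity bound for graphs with exactly `m` edges. -/
theorem boundExpr_le_cost {ε : ℝ} (hε0 : 0 < ε) (hε : ε ≤ 1) {n m k b : ℕ}
    (hC : 4000000 / ε * Real.logb 2 n ≤ k) (hkn : k ≤ n) (hnm : n ≤ m)
    (hm : (m : ℝ) ≤ (1 - ε) * (n.choose 2 : ℝ))
    (h : HasRandomizedProtocol (edgePartitions k n {m}) (connectivity k n) (1 / 3) b) :
    ε ^ 2 / 12288000000000 * boundExpr n m k ≤ b := by
  rcases le_or_gt n 1 with hn | hn
  · rw [boundExpr_of_le_one (hkn.trans hn), mul_zero]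
    exact Nat.cast_nonneg b
  have hn2 : (2 : ℝ) ≤ n := by exact_mod_cast hn
  have hlogn : 1 ≤ Real.logb 2 n := by
    rw [Real.le_logb_iff_rpow_le (by norm_num) (by linarith)]
    simpa using hn2
  -- The logarithmic lower bound on `k` enters only through this constant bound, which makes `K`
  -- positive and the additive constants negligible against `ε * n`.
  have hkC : 4000000 / ε ≤ k :=
    (le_mul_of_one_le_right (by positivity) hlogn).trans hC
  rw [div_le_iff₀ hε0] at hkC
  have hkR : (4000000 : ℝ) ≤ k := by nlinarith [(Nat.cast_nonneg k : (0 : ℝ) ≤ k)]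
  have hk2 : 2 ≤ k := by
    have : (2 : ℝ) ≤ k := by linarith
    exact_mod_cast this
  have hknR : (k : ℝ) ≤ n := by exact_mod_cast hkn
  have hnmR : (n : ℝ) ≤ m := by exact_mod_cast hnm
  have hk0 : (0 : ℝ) < k := by linarith
  set ρ : ℝ := min (n : ℝ) ((m : ℝ) / k) with hρ
  have hρn : ρ ≤ n := min_le_left _ _
  have hρm : k * ρ ≤ m := by
    have : ρ ≤ m / k := min_le_right _ _
    rw [le_div_iff₀ hk0] at this
    linarith
  have hρ1 : 1 ≤ ρ := by
    refine le_min (by linarith) ?_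
    rw [le_div_iff₀ hk0]; linarith
  set K : ℕ := ⌊ε / 2000000 * k⌋₊ with hKdef
  -- The offset secures `r ≥ 4608`; as `ρ ≥ 1`, it costs only a constant factor in the upper bounds
  -- on `r`.
  set r : ℕ := 4608 + ⌊ε / 200 * ρ⌋₊ with hrdef
  have hKu : (K : ℝ) ≤ ε / 2000000 * k := Nat.floor_le (by positivity)
  have hKl : ε / 4000000 * k ≤ K := by
    have := Nat.lt_floor_add_one (ε / 2000000 * k)
    rw [← hKdef] at this
    linarith
  have hru : (r : ℝ) ≤ 4608 + ε / 200 * ρ := by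
    rw [hrdef]; push_cast
    linarith [Nat.floor_le (show 0 ≤ ε / 200 * ρ by positivity)]
  have hrl : ε / 200 * ρ ≤ r := by
    have := Nat.lt_floor_add_one (ε / 200 * ρ)
    rw [hrdef]; push_cast
    linarith
  have hru' : (r : ℝ) ≤ 4609 * ρ := by nlinarith
  have hKru : (K * r : ℝ) ≤ 4609 / 2000000 * ε * (k * ρ) := by
    calc (K * r : ℝ) ≤ (ε / 2000000 * k) * (4609 * ρ) := by gcongr
      _ = _ := by ring
  have hKrm : (K * r : ℝ) ≤ 4609 / 2000000 * ε * m :=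
    hKru.trans (mul_le_mul_of_nonneg_left hρm (by positivity))
  have hεn : 4000000 ≤ ε * n := by nlinarith
  have hεk : ε * k ≤ ε * n := by gcongr
  have hm0 : (0 : ℝ) ≤ m := Nat.cast_nonneg m
  have hmain : (K * r : ℝ) ≤ 15360 * (b * Real.logb 2 k) := by
    refine mul_le_cost hε0 hε hnm hm hk2 ?_ ?_ (by omega) ?_ ?_ ?_ h
    · have : (K : ℝ) < k := by nlinarith
      exact_mod_cast this
    · have : (0 : ℝ) < K := by nlinarith
      exact_mod_cast this
    · have : (2 * (K * r) : ℝ) ≤ m := by nlinarith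
      exact_mod_cast this
    · push_cast
      have : ε * ρ ≤ ε * n := by gcongr
      linarith
    · intro hlt
      have hltR : (m : ℝ) ≤ 2 * n := by exact_mod_cast hlt.le
      have : ε * m ≤ ε * (2 * n) := by gcongr
      push_cast
      linarith
  have hlow : ε ^ 2 / 800000000 * (k * ρ) ≤ K * r := by
    calc ε ^ 2 / 800000000 * (k * ρ) = (ε / 4000000 * k) * (ε / 200 * ρ) := by ring
      _ ≤ K * r := by gcongr
  have hlogk : 0 < Real.logb 2 k := Real.logb_pos (by norm_num) (by linarith)
  rw [boundExpr, ← hρ, ← mul_div_assoc, div_le_iff₀ hlogk]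
  nlinarith

/-- For `m ≥ n * n / 4` and `k ≤ n` the minimum is already within a constant factor of `n`; the
factor 8 also covers the rounding of `n * n / 4`. -/
lemma boundExpr_le_of_truncation {n m k : ℕ} (hn : 4 ≤ n) (hk : 2 ≤ k) (hkn : k ≤ n) :
    boundExpr n m k ≤ 8 * boundExpr n (min m (n * n / 4)) k := by
  have hk0 : (0 : ℝ) < k := by positivity
  have hlogk : 0 < Real.logb 2 k :=
    Real.logb_pos (by norm_num) (by exact_mod_cast (show 1 < k by omega))
  have hknR : (k : ℝ) ≤ n := by exact_mod_cast hkn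
  unfold boundExpr
  rw [← mul_div_assoc, div_le_div_iff_of_pos_right hlogk, mul_left_comm]
  refine mul_le_mul_of_nonneg_left ?_ hk0.le
  rw [mul_min_of_nonneg _ _ (by norm_num : (0 : ℝ) ≤ 8)]
  have hn0 : (0 : ℝ) ≤ n := Nat.cast_nonneg n
  refine le_min ((min_le_left _ _).trans (by linarith)) ?_
  rcases le_total m (n * n / 4) with h | h
  · rw [min_eq_left h]
    refine (min_le_right _ _).trans ?_
    have : (0 : ℝ) ≤ m / k := by positivity
    linarith
  · rw [min_eq_right h]
    refine (min_le_left _ _).trans ?_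
    have h1 : n * n ≤ 8 * (n * n / 4) := by
      have : 16 ≤ n * n := Nat.mul_le_mul hn hn
      omega
    have h2 : (n * n : ℝ) ≤ 8 * (n * n / 4 : ℕ) := by exact_mod_cast h1
    rw [← mul_div_assoc, le_div_iff₀ hk0]
    nlinarith

/-- The connectivity bound for graphs with at most `m` edges. -/
theorem boundExpr_le_cost_of_le {n m k b : ℕ}
    (hC : 16000000 * Real.logb 2 n ≤ k) (hkn : k ≤ n) (hnm : n ≤ m)
    (h : HasRandomizedProtocol (edgePartitions k n (Set.Iic m)) (connectivity k n) (1 / 3) b) :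
    1 / 8 * ((1 / 4) ^ 2 / 12288000000000) * boundExpr n m k ≤ b := by
  rcases le_or_gt k 1 with hk | hk
  · rw [boundExpr_of_le_one hk, mul_zero]
    exact Nat.cast_nonneg b
  have hn2 : (2 : ℝ) ≤ n := by exact_mod_cast (show 2 ≤ n by omega)
  have hlogn : 1 ≤ Real.logb 2 n := by
    rw [Real.le_logb_iff_rpow_le (by norm_num) (by linarith)]
    simpa using hn2
  have hn4 : 4 ≤ n := by
    have : (4 : ℝ) ≤ k := by linarith
    have : 4 ≤ k := by exact_mod_cast this
    omega
  have h4 : 4 * n ≤ n * n := Nat.mul_le_mul_right n hn4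
  -- Keeps the number of edges below three quarters of all pairs, so that the exact version applies
  -- with `ε = 1 / 4`.
  set m' := min m (n * n / 4) with hm'
  have hnm' : n ≤ m' := le_min hnm (by omega)
  have hm'u : (m' : ℝ) ≤ (1 - 1 / 4) * (n.choose 2 : ℝ) := by
    have h1 : m' ≤ n * n / 4 := min_le_right _ _
    have h2 : (4 * m' : ℝ) ≤ n * n := by
      have : 4 * m' ≤ n * n := by omega
      exact_mod_cast this
    rw [Nat.cast_choose_two]
    have : (4 : ℝ) ≤ n := by exact_mod_cast hn4
    nlinarith
  have hsub : edgePartitions k n {m'} ⊆ edgePartitions k n (Set.Iic m) := by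
    rintro x ⟨hx1, hx2⟩
    refine ⟨hx1, ?_⟩
    rw [Set.mem_singleton_iff] at hx2
    rw [hx2]
    exact Set.mem_Iic.2 (min_le_left m _)
  have := boundExpr_le_cost (ε := 1 / 4) (by norm_num) (by norm_num) (by linarith) hkn hnm' hm'u
    (h.mono hsub)
  have h8 := boundExpr_le_of_truncation (m := m) hn4 hk hkn
  linarith

end Parameters

end MessagePassing

theorem mainTheorem5 :
    -- graphs with `n` vertices and at most `m` edges, for every `m ≥ n`
    (∃ C : ℝ, 0 < C ∧ ∃ c : ℝ, 0 < c ∧ ∀ n m k : ℕ,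
      C * Real.logb 2 (n : ℝ) ≤ (k : ℝ) → k ≤ min n m → n ≤ m →
        ENNReal.ofReal (c * MessagePassing.boundExpr n m k) ≤
          (MessagePassing.randCC (MessagePassing.edgePartitions k n (Set.Iic m))
            (MessagePassing.connectivity k n) (1 / 3) : ℝ≥0∞) ∧
        ENNReal.ofReal (c * MessagePassing.boundExpr n m k) ≤
          (MessagePassing.randCC (MessagePassing.edgePartitions k n (Set.Iic m))
            (MessagePassing.numComponents k n) (1 / 3) : ℝ≥0∞)) ∧
    -- graphs with `n` vertices and exactly `m` edges, bounded away from complete graphs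
    (∀ ε : ℝ, 0 < ε → ∃ C : ℝ, 0 < C ∧ ∃ c : ℝ, 0 < c ∧ ∀ n m k : ℕ,
      C * Real.logb 2 (n : ℝ) ≤ (k : ℝ) → k ≤ min n m → n ≤ m →
      (m : ℝ) ≤ (1 - ε) * (n.choose 2 : ℝ) →
        ENNReal.ofReal (c * MessagePassing.boundExpr n m k) ≤
          (MessagePassing.randCC (MessagePassing.edgePartitions k n {m})
            (MessagePassing.connectivity k n) (1 / 3) : ℝ≥0∞) ∧
        ENNReal.ofReal (c * MessagePassing.boundExpr n m k) ≤
          (MessagePassing.randCC (MessagePassing.edgePartitions k n {m})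
            (MessagePassing.numComponents k n) (1 / 3) : ℝ≥0∞)) := by
  refine ⟨⟨16000000, by norm_num, 1 / 8 * ((1 / 4) ^ 2 / 12288000000000), by norm_num, ?_⟩, ?_⟩
  · intro n m k hC hk hnm
    have hkn : k ≤ n := hk.trans (min_le_left n m)
    exact ⟨MessagePassing.ofReal_le_randCC fun b h =>
        MessagePassing.boundExpr_le_cost_of_le hC hkn hnm h,
      MessagePassing.ofReal_le_randCC fun b h =>
        MessagePassing.boundExpr_le_cost_of_le hC hkn hnm h.connectivity⟩
  · intro ε hε
    -- For `ε > 1` the edge bound only weakens on replacing `ε` by 1.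
    have hε' : 0 < min ε 1 := lt_min hε one_pos
    refine ⟨4000000 / min ε 1, by positivity, (min ε 1) ^ 2 / 12288000000000, by positivity, ?_⟩
    intro n m k hC hk hnm hm
    have hkn : k ≤ n := hk.trans (min_le_left n m)
    have hm' : (m : ℝ) ≤ (1 - min ε 1) * (n.choose 2 : ℝ) :=
      hm.trans (mul_le_mul_of_nonneg_right (by linarith [min_le_left ε 1]) (Nat.cast_nonneg _))
    exact ⟨MessagePassing.ofReal_le_randCC fun b h =>
        MessagePassing.boundExpr_le_cost hε' (min_le_right _ _) hC hkn hnm hm' h,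
      MessagePassing.ofReal_le_randCC fun b h =>
        MessagePassing.boundExpr_le_cost hε' (min_le_right _ _) hC hkn hnm hm' h.connectivity⟩
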